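/- Let $\lambda\in\mathbb R$, $M,Q\ge 0$, and consider the Reissner–Nordström–(anti) de Sitter (RNdS) metric \[\mathrm ds^2=-\Delta\,\mathrm dt^2+\frac{\mathrm dr^2}{\Delta}+r^2(\mathrm d\theta^2+\sin^2\theta\,\mathrm d\varphi^2),\qquad \Delta=1-\lambda r^2-\frac{2M}{r}+\frac{Q^2}{r^2},\] extended across its horizons $\Delta=0$ by the ingoing and outgoing Eddington–Finkelstein coordinates, on $\{r\neq0\}$. Let $L\in\mathbb R\setminus\{0\}$, $E>0$, $r_0>0$, $\dot r_0\in\mathbb R$ with $\lambda L^2+E^2\ge 0$. Let $\gamma$ be an equatorial ($\theta=\pi/2$) null geodesic, defined on an open interval (for instance the maximal one), with energy $E=-p_t$ and angular momentum $L=p_\varphi$. Denote by $r=r(\varphi)$ its radius in polar parametrization ($\varphi$ being lifted to a real-valued function along $\gamma$) and suppose that $\varphi=0$ is attained, with $r(0)=r_0$ and $\frac{\mathrm dr}{\mathrm d\varphi}(0)=\dot r_0$. Let $\delta=\lambda+E^2/L^2$, let $\bar r\in\mathbb R$ be any real root of $\delta x^4-x^2+2Mx-Q^2$ with $\bar r\ne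 r_0$, and put \[\gamma_1=4\bar r\delta,\quad \beta=6\bar r^2\delta-1,\quad \alpha=4\bar r^3\delta-2\bar r+2M,\] \[g_2=\tfrac14\Big(\tfrac{\beta^2}{3}-\alpha\gamma_1\Big),\qquad g_3=\tfrac18\Big(\tfrac{\alpha\beta\gamma_1}{6}-\tfrac{\alpha^2\delta}{2}-\tfrac{\beta^3}{27}\Big).\] Assume $g_2^3-27g_3^2\neq0$. Let $\wp=\wp_{g_2,g_3}$ be the Weierstrass function of the lattice $\Lambda\subset\mathbb C$ with invariants $g_2,g_3$, let $z_1,z_2,z_3\in\mathbb C$ be the roots of $4z^3-g_2z-g_3$, and let \[\wp_0=\frac{\alpha}{4(r_0-\bar r)}+\frac{\beta}{12},\qquad z_0=\varepsilon\,R_F(\wp_0-z_1,\wp_0-z_2,\wp_0-z_3),\] \[R_F(x,y,z)=\frac12\int_0^\infty\frac{\mathrm d\zeta}{\sqrt{(\zeta+x)(\zeta+y)(\zeta+z)}},\] where the square root is the principal one and $\varepsilon=1$ if $\alpha\dot r_0\ge0$, $\varepsilon=-1$ if $\alpha\dot r_0<0$. (Equivalently, $z_0=R_F(\ldots)$ with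 the branch of the square root chosen according to the sign of $\alpha\dot r_0$.) Then the integral defining $z_0$ converges absolutely, and for every $\varphi$ in the domain of $r$, \[r(\varphi)=\bar r+\frac{\alpha}{4\wp(z_0+\varphi)-\beta/3},\] where the denominator does not vanish when $z_0+\varphi\notin\Lambda$, and where the formula is read as $r(\varphi)=\bar r$ when $z_0+\varphi\in\Lambda$ (the poles of $\wp$). -/

import Mathlib

open Set MeasureTheory

namespace RNdS

noncomputable section

/-! ## Geodesics in a coordinate patch of `ℝⁿ` -/

/-- The `α`-th coordinate partial derivative of `f` at `x`. -/
def pderiv {n : ℕ} (f : (Fin n → ℝ) → ℝ) (α : Fin n) (x : Fin n → ℝ) : ℝ :=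
  deriv (fun s : ℝ => f (Function.update x α s)) (x α)

/-- The Christoffel symbols `Γ^μ_{αβ} = ½ g^{μν} (g_{νβ,α} + g_{να,β} - g_{αβ,ν})` of the metric
with coefficient matrix `g`. -/
def christoffel {n : ℕ} (g : (Fin n → ℝ) → Matrix (Fin n) (Fin n) ℝ) (μ α β : Fin n)
    (x : Fin n → ℝ) : ℝ :=
  1 / 2 * ∑ ν, (g x)⁻¹ μ ν *
    (pderiv (fun y => g y ν β) α x + pderiv (fun y => g y ν α) β x
      - pderiv (fun y => g y α β) ν x)

/-- The `μ`-th component of the velocity of the coordinate curve `c`. -/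
def velocity {n : ℕ} (c : ℝ → Fin n → ℝ) (μ : Fin n) (l : ℝ) : ℝ :=
  deriv (fun s => c s μ) l

/-- The conjugate momentum `p_μ = g_{μν} ċ^ν` of an uncharged particle. -/
def momentum {n : ℕ} (g : (Fin n → ℝ) → Matrix (Fin n) (Fin n) ℝ) (c : ℝ → Fin n → ℝ)
    (μ : Fin n) (l : ℝ) : ℝ :=
  ∑ ν, g (c l) μ ν * velocity c ν l

/-- `c` is, on the open set `J` of affine parameters, an affinely parametrized geodesic of the
metric `g` on the coordinate domain `U`: it satisfies `c̈^μ + Γ^μ_{αβ} ċ^α ċ^β = 0`. -/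
structure IsGeodesicOn {n : ℕ} (g : (Fin n → ℝ) → Matrix (Fin n) (Fin n) ℝ)
    (U : Set (Fin n → ℝ)) (c : ℝ → Fin n → ℝ) (J : Set ℝ) : Prop where
  mem : ∀ l ∈ J, c l ∈ U
  contDiffOn : ContDiffOn ℝ 2 c J
  geodesic_eq : ∀ l ∈ J, ∀ μ,
    deriv (velocity c μ) l
      + ∑ α, ∑ β, christoffel g μ α β (c l) * velocity c α l * velocity c β l = 0

/-! ## The Reissner–Nordström–(anti) de Sitter spacetime

`lam` is one third of the cosmological constant, `M` the mass and `Q` the charge. -/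

/-- The function `1 - λ r² - 2 M / r + Q² / r²`. -/
def horizonFn (lam M Q r : ℝ) : ℝ := 1 - lam * r ^ 2 - 2 * M / r + Q ^ 2 / r ^ 2

/-- The kinds of coordinate patches used for the (extended) spacetime. The last three coordinates
are always `(r, θ, φ)`. The first one is the Boyer–Lindquist time `t` in the `static` patches, which
avoid the horizons, and `t + ∫ dr / Δ`, resp. `t - ∫ dr / Δ` (with `Δ` the function `horizonFn`) in
the `ingoing`, resp. `outgoing`, (Eddington–Finkelstein) patches, in which the metric is regular
across the horizons. -/
inductive Patch where
  | static
  | ingoing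
  | outgoing

/-- The metric. In a static patch,
`ds² = -Δ dt² + dr² / Δ + r² (dθ² + sin² θ dφ²)`; substituting `t = v ∓ ∫ dr / Δ` one gets
`ds² = -Δ dv² ± 2 dv dr + r² (dθ² + sin² θ dφ²)` in the ingoing and outgoing patches. -/
def metric (lam M Q : ℝ) : Patch → (Fin 4 → ℝ) → Matrix (Fin 4) (Fin 4) ℝ
  | .static, x =>
      !![-horizonFn lam M Q (x 1), 0, 0, 0;
         0, 1 / horizonFn lam M Q (x 1), 0, 0;
         0, 0, x 1 ^ 2, 0;
         0, 0, 0, x 1 ^ 2 * Real.sin (x 2) ^ 2]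
  | .ingoing, x =>
      !![-horizonFn lam M Q (x 1), 1, 0, 0;
         1, 0, 0, 0;
         0, 0, x 1 ^ 2, 0;
         0, 0, 0, x 1 ^ 2 * Real.sin (x 2) ^ 2]
  | .outgoing, x =>
      !![-horizonFn lam M Q (x 1), -1, 0, 0;
         -1, 0, 0, 0;
         0, 0, x 1 ^ 2, 0;
         0, 0, 0, x 1 ^ 2 * Real.sin (x 2) ^ 2]

/-- The coordinate domain of a patch. -/
def domain (lam M Q : ℝ) : Patch → Set (Fin 4 → ℝ)
  | .static => {x | x 1 ≠ 0 ∧ Real.sin (x 2) ≠ 0 ∧ horizonFn lam M Q (x 1) ≠ 0}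
  | .ingoing => {x | x 1 ≠ 0 ∧ Real.sin (x 2) ≠ 0}
  | .outgoing => {x | x 1 ≠ 0 ∧ Real.sin (x 2) ≠ 0}

/-- `r` and `φ` are the radial and (lifted, real valued) azimuthal coordinates of an equatorial null
geodesic with energy `E` and angular momentum `L`, parametrized by the open interval `I`. Since no
single time coordinate covers a curve that crosses horizons, the time coordinate `w` is only given
patchwise: around each parameter, `(w, r, π/2, φ)` is, in some patch, a geodesic with
`g_{μν} ċ^μ ċ^ν = 0`, `E = -p_t` and `L = p_φ`. For a curve that stays in `Δ ≠ 0`, the static patch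
can be used with `J = I`. -/
structure IsEquatorialNullGeodesic (lam M Q E L : ℝ) (I : Set ℝ) (r φ : ℝ → ℝ) : Prop where
  isOpen : IsOpen I
  isPreconnected : IsPreconnected I
  exists_patch : ∀ l₀ ∈ I, ∃ (p : Patch) (w : ℝ → ℝ) (J : Set ℝ),
    IsOpen J ∧ l₀ ∈ J ∧ J ⊆ I ∧
    IsGeodesicOn (metric lam M Q p) (domain lam M Q p)
      (fun l => ![w l, r l, Real.pi / 2, φ l]) J ∧
    ∀ l ∈ J,
      (∑ μ, momentum (metric lam M Q p) (fun l => ![w l, r l, Real.pi / 2, φ l]) μ l *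
        velocity (fun l => ![w l, r l, Real.pi / 2, φ l]) μ l = 0) ∧
      -momentum (metric lam M Q p) (fun l => ![w l, r l, Real.pi / 2, φ l]) 0 l = E ∧
      momentum (metric lam M Q p) (fun l => ![w l, r l, Real.pi / 2, φ l]) 3 l = L

/-! ## Carlson's symmetric elliptic integral of the first kind -/

/-- The integrand `1 / √((ζ + x) (ζ + y) (ζ + z))`, with the principal square root. -/
def carlsonIntegrand (x y z : ℂ) (ζ : ℝ) : ℂ :=
  1 / (((ζ : ℂ) + x) * ((ζ : ℂ) + y) * ((ζ : ℂ) + z)) ^ (1 / 2 : ℂ)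

/-- `R_F(x, y, z) = ½ ∫₀^∞ dζ / √((ζ + x) (ζ + y) (ζ + z))`. -/
def carlsonRF (x y z : ℂ) : ℂ :=
  1 / 2 * ∫ ζ in Ioi (0 : ℝ), carlsonIntegrand x y z ζ

end

end RNdS

/-! Energy and angular momentum give `(dr/dφ)² = f(r)` with `f x = δ x⁴ - x² + 2 M x - Q²`. The
Taylor coefficients of `f` at its root `rbar` are `α, β, γ, δ`, and `r = rbar + (α / 4) u` turns the
equation into `u'² = k(u)`, where `k` is `invQuartic c g₂ g₃` with `c = β / 12`. The function `1 /
(℘ - c)` solves the same equation and extends holomorphically by `0` to the poles of `℘`, which is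
where `r = rbar`.

The first-order equation loses uniqueness at turning points, so the two functions are compared
through `u'' = k'(u) / 2`. For the orbit it comes from the geodesic equation (`orbit_eq`), for `1 /
(℘ - c)` from `deriv_deriv_invWP`. Uniqueness then spreads over the whole range of `φ`
(`invWP_line_eq_of_ode`).

What remains is the initial data: `℘ z₀ = wp₀` and the correct sign of `℘' z₀`
(`weierstrassP_carlsonRF`). The difficulty is that `wp₀` may lie below real roots of the cubic, so
that the principal square root switches between real and imaginary values along the integration
path. With `u = 1 / (1 + ζ)`, `R_F` becomes `∫ du / √k` over `[0, 1]`, now with `c = wp₀ - 1`, and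
`invertsAt_of_mem_Icc` inverts this integral by continuous induction on its upper limit. Its value
moves along a straight line on which `1 / (℘ - c)` is real, and may turn by a right angle at a root
of `k`. The nonzero discriminant makes all roots simple, hence the integral convergent and the
continuation past a root possible. -/

open Filter Topology

/-! ### The quartic attached to the Weierstrass cubic -/

/-- The quartic `u⁴ p (c + 1 / u)` attached to the Weierstrass cubic `p s = 4 s³ - g₂ s - g₃`. -/
def invQuartic {A : Type*} [Field A] (c g₂ g₃ u : A) : A :=
  4 * u * (1 + c * u) ^ 3 - g₂ * u ^ 3 * (1 + c * u) - g₃ * u ^ 4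

/-- Half of the derivative of `invQuartic`. -/
def invQuarticHalfDeriv {A : Type*} [Field A] (c g₂ g₃ u : A) : A :=
  2 + 12 * c * u + 3 / 2 * (12 * c ^ 2 - g₂) * u ^ 2 + 2 * (4 * c ^ 3 - g₂ * c - g₃) * u ^ 3

lemma hasDerivAt_invQuartic {𝕜 : Type*} [NontriviallyNormedField 𝕜] [CharZero 𝕜] (c g₂ g₃ u : 𝕜) :
    HasDerivAt (invQuartic c g₂ g₃) (2 * invQuarticHalfDeriv c g₂ g₃ u) u := by
  have hid := hasDerivAt_id u
  have h1 : HasDerivAt (fun u : 𝕜 => 1 + c * u) c u := by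
    simpa using (hid.const_mul c).const_add 1
  have h := (((hid.const_mul 4).mul (h1.pow 3)).sub
    (((hid.pow 3).const_mul g₂).mul h1)).sub ((hid.pow 4).const_mul g₃)
  refine h.congr_deriv ?_
  simp only [id, invQuarticHalfDeriv, Pi.pow_apply]
  field_simp
  ring

lemma contDiff_invQuarticHalfDeriv {𝕜 : Type*} [NontriviallyNormedField 𝕜] (c g₂ g₃ : 𝕜)
    {n : WithTop ℕ∞} : ContDiff 𝕜 n (invQuarticHalfDeriv c g₂ g₃) := by
  unfold invQuarticHalfDeriv
  fun_prop

lemma continuous_invQuartic {𝕜 : Type*} [NontriviallyNormedField 𝕜] (c g₂ g₃ : 𝕜) :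
    Continuous (invQuartic c g₂ g₃) := by
  unfold invQuartic
  fun_prop

/-! ### The function `1 / (℘ - c)` and its differential equations -/

namespace PeriodPair

variable (Λ : PeriodPair) (c : ℂ)

open Classical in
/-- The function `1 / (℘ - c)`, extended by `0` to the poles of `℘`. -/
noncomputable def invWP (z : ℂ) : ℂ :=
  if z ∈ Λ.lattice then 0 else 1 / (Λ.weierstrassP z - c)

/-- The complement of the poles of `1 / (℘ - c)`. -/
def regularSet : Set ℂ := {z | z ∈ Λ.lattice ∨ Λ.weierstrassP z ≠ c}

variable {Λ c} {z : ℂ}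

lemma invWP_of_mem (hz : z ∈ Λ.lattice) : Λ.invWP c z = 0 := if_pos hz

lemma invWP_of_notMem (hz : z ∉ Λ.lattice) : Λ.invWP c z = 1 / (Λ.weierstrassP z - c) := if_neg hz

lemma eventually_notMem_lattice (hz : z ∉ Λ.lattice) : ∀ᶠ w in 𝓝 z, w ∉ Λ.lattice :=
  Λ.isClosed_lattice.isOpen_compl.mem_nhds hz

lemma invWP_eventuallyEq_of_notMem (hz : z ∉ Λ.lattice) :
    Λ.invWP c =ᶠ[𝓝 z] fun w => 1 / (Λ.weierstrassP w - c) :=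
  (eventually_notMem_lattice hz).mono fun _ hw => invWP_of_notMem hw

/-- Here `D` is `(w - z)² (℘ w - c)` with its removable singularity at `z` filled in. It shows that
`1 / (℘ - c)` is analytic at the poles of `℘`, with a double zero there. -/
lemma exists_invWP_eventuallyEq_div (c : ℂ) (hz : z ∈ Λ.lattice) :
    ∃ D : ℂ → ℂ, AnalyticAt ℂ D z ∧ D z = 1 ∧
      (∀ᶠ w in 𝓝 z, Λ.invWP c w = (w - z) ^ 2 / D w) ∧ ∀ᶠ w in 𝓝 z, w ∈ Λ.regularSet c := by
  -- For `z = 0` the convention `a / 0 = 0` drops the term `(w - z)² / z²`, in agreement with the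
  -- lattice sum, whose term at `0` carries no correction.
  set D : ℂ → ℂ := fun w => (w - z) ^ 2 * Λ.weierstrassPExcept z w + 1 - (w - z) ^ 2 / z ^ 2
    - c * (w - z) ^ 2 with hD
  have hDa : AnalyticAt ℂ D z := by
    have := Λ.analyticAt_weierstrassPExcept z
    simp only [hD, div_eq_mul_inv]
    fun_prop
  have hD1 : D z = 1 := by simp [hD]
  have hne : ∀ᶠ w in 𝓝 z, D w ≠ 0 := hDa.continuousAt.eventually_ne (by simp [hD1])
  have hlat := Λ.compl_lattice_sdiff_singleton_mem_nhds z
  have key : ∀ᶠ w in 𝓝 z, w ≠ z → w ∉ Λ.lattice ∧ D w ≠ 0 ∧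
      (w - z) ^ 2 * (Λ.weierstrassP w - c) = D w := by
    filter_upwards [hne, hlat] with w hw hwl hwz
    refine ⟨fun h => hwl ⟨h, hwz⟩, hw, ?_⟩
    have := Λ.ite_eq_one_sub_sq_mul_weierstrassP z hz w
    rw [if_neg hwz] at this
    simp only [hD]
    linear_combination this
  refine ⟨D, hDa, hD1, key.mono fun w hw => ?_, key.mono fun w hw => ?_⟩
  · by_cases hwz : w = z
    · simp [hwz, invWP_of_mem hz]
    · obtain ⟨h1, h2, h3⟩ := hw hwz
      have h4 : Λ.weierstrassP w - c ≠ 0 := fun h => h2 (by rw [← h3, h, mul_zero])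
      rw [invWP_of_notMem h1, div_eq_div_iff h4 h2, h3, one_mul]
  · by_cases hwz : w = z
    · exact Or.inl (hwz ▸ hz)
    · obtain ⟨-, h2, h3⟩ := hw hwz
      exact Or.inr fun h => h2 (by rw [← h3, h, sub_self, mul_zero])

lemma analyticAt_weierstrassP (hz : z ∉ Λ.lattice) : AnalyticAt ℂ Λ.weierstrassP z :=
  Λ.analyticOnNhd_weierstrassP z hz

lemma isOpen_regularSet : IsOpen (Λ.regularSet c) := by
  refine isOpen_iff_mem_nhds.2 fun z hz => ?_
  by_cases hl : z ∈ Λ.lattice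
  · exact (exists_invWP_eventuallyEq_div c hl).choose_spec.2.2.2
  · exact ((analyticAt_weierstrassP hl).continuousAt.eventually_ne (hz.resolve_left hl)).mono
      fun _ => Or.inr

lemma analyticAt_invWP (hz : z ∈ Λ.regularSet c) : AnalyticAt ℂ (Λ.invWP c) z := by
  by_cases hl : z ∈ Λ.lattice
  · obtain ⟨D, hD, hD1, hev, -⟩ := exists_invWP_eventuallyEq_div c hl
    refine AnalyticAt.congr ?_ (EventuallyEq.symm hev)
    exact ((analyticAt_id.sub analyticAt_const).pow 2).div hD (by simp [hD1])
  · refine AnalyticAt.congr ?_ (invWP_eventuallyEq_of_notMem hl).symm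
    exact analyticAt_const.div ((analyticAt_weierstrassP hl).sub analyticAt_const)
      (sub_ne_zero.2 (hz.resolve_left hl))

lemma deriv_invWP_of_mem (hz : z ∈ Λ.lattice) : deriv (Λ.invWP c) z = 0 := by
  obtain ⟨D, hD, hD1, hev, -⟩ := exists_invWP_eventuallyEq_div c hz
  rw [EventuallyEq.deriv_eq hev]
  have h := (((hasDerivAt_id z).sub_const z).pow 2).div hD.differentiableAt.hasDerivAt
    (by simp [hD1])
  exact h.deriv.trans (by simp)

lemma deriv_invWP_of_notMem (hl : z ∉ Λ.lattice) (hc : Λ.weierstrassP z ≠ c) :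
    deriv (Λ.invWP c) z = -Λ.derivWeierstrassP z / (Λ.weierstrassP z - c) ^ 2 := by
  rw [EventuallyEq.deriv_eq (invWP_eventuallyEq_of_notMem hl)]
  have h1 := (analyticAt_weierstrassP hl).differentiableAt.hasDerivAt
  rw [Λ.deriv_weierstrassP] at h1
  simp only [one_div]
  exact ((h1.sub_const c).inv (sub_ne_zero.2 hc)).deriv

lemma deriv_invWP_sq (hz : z ∈ Λ.regularSet c) :
    deriv (Λ.invWP c) z ^ 2 = invQuartic c Λ.g₂ Λ.g₃ (Λ.invWP c z) := by
  by_cases hl : z ∈ Λ.lattice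
  · simp [deriv_invWP_of_mem hl, invWP_of_mem hl, invQuartic]
  · have hc := hz.resolve_left hl
    have hc' := sub_ne_zero.2 hc
    rw [deriv_invWP_of_notMem hl hc, invWP_of_notMem hl, div_pow, neg_sq,
      Λ.derivWeierstrassP_sq z hl, invQuartic]
    field_simp
    ring

lemma isPreconnected_compl_lattice : IsPreconnected ((Λ.lattice : Set ℂ)ᶜ) := by
  have hc : ((Λ.lattice : Set ℂ)).Countable := by
    have : Countable Λ.lattice := Λ.latticeEquivProd.toEquiv.countable_iff.2 inferInstance
    exact Set.to_countable _
  exact (hc.isPathConnected_compl_of_one_lt_rank (by simp)).isConnected.isPreconnected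

lemma tendsto_weierstrassP_cobounded (hz : z ∈ Λ.lattice) :
    Tendsto Λ.weierstrassP (𝓝[≠] z) (Bornology.cobounded ℂ) := by
  rw [tendsto_cobounded_iff_meromorphicOrderAt_neg (Λ.meromorphic_weierstrassP z),
    Λ.order_weierstrassP z hz]
  decide

/-- Removing a countable set leaves the plane connected, so by the identity theorem `℘` would be
constant off the lattice, against its pole at `0`. -/
lemma not_eventually_derivWeierstrassP_eq_zero (hz : z ∉ Λ.lattice) :
    ¬ ∀ᶠ w in 𝓝 z, Λ.derivWeierstrassP w = 0 := by
  intro h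
  have h0 : EqOn Λ.derivWeierstrassP 0 (Λ.lattice : Set ℂ)ᶜ :=
    Λ.analyticOnNhd_derivWeierstrassP.eqOn_zero_of_preconnected_of_eventuallyEq_zero
      isPreconnected_compl_lattice hz h
  obtain ⟨a, ha⟩ := Λ.isClosed_lattice.isOpen_compl.exists_is_const_of_deriv_eq_zero
    isPreconnected_compl_lattice Λ.differentiableOn_weierstrassP
    (by rw [Λ.deriv_weierstrassP]; exact h0)
  have hmem := Λ.lattice.zero_mem
  have h1 : ∀ᶠ w in 𝓝[≠] (0 : ℂ), Λ.weierstrassP w = a := by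
    have := Λ.compl_lattice_sdiff_singleton_mem_nhds 0
    filter_upwards [self_mem_nhdsWithin, mem_nhdsWithin_of_mem_nhds this] with w hw hw'
    exact ha w fun hl => hw' ⟨hl, hw⟩
  have h2 := (tendsto_weierstrassP_cobounded hmem).eventually
    (show ∀ᶠ w in Bornology.cobounded ℂ, w ≠ a from Bornology.isBounded_singleton)
  obtain ⟨w, hw, hw'⟩ := (h1.and h2).exists
  exact hw' hw

lemma not_eventually_deriv_invWP_eq_zero (hz : z ∈ Λ.regularSet c) :
    ¬ ∀ᶠ w in 𝓝 z, deriv (Λ.invWP c) w = 0 := by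
  intro h
  have hlat := Λ.compl_lattice_sdiff_singleton_mem_nhds z
  have hreg : ∀ᶠ w in 𝓝 z, w ∈ Λ.regularSet c := isOpen_regularSet.mem_nhds hz
  have h' := (h.and (hreg.and hlat)).eventually_nhds
  -- The point `z` may itself be a lattice point, so the argument moves to a nearby one that is not.
  obtain ⟨w, hw, hwz⟩ := ((h'.filter_mono nhdsWithin_le_nhds).and
    (self_mem_nhdsWithin : {z}ᶜ ∈ 𝓝[≠] z)).exists
  have hwl : w ∉ Λ.lattice := fun hl => hw.self_of_nhds.2.2 ⟨hl, hwz⟩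
  refine not_eventually_derivWeierstrassP_eq_zero hwl ?_
  filter_upwards [hw, eventually_notMem_lattice hwl] with v hv hvl
  have hc := hv.2.1.resolve_left hvl
  have := hv.1
  rw [deriv_invWP_of_notMem hvl hc, div_eq_zero_iff] at this
  simpa [sub_ne_zero.2 hc] using this

/-- Differentiating `U'² = k(U)` gives `U' (U'' - k'(U) / 2) = 0`. Zeros of `U'` are isolated, so
the second factor vanishes on a punctured neighbourhood, and at `z` by continuity. -/
lemma deriv_deriv_invWP (hz : z ∈ Λ.regularSet c) :
    deriv (deriv (Λ.invWP c)) z = invQuarticHalfDeriv c Λ.g₂ Λ.g₃ (Λ.invWP c z) := by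
  have hU := analyticAt_invWP hz
  have hDa := hU.deriv
  have hG : AnalyticAt ℂ (fun w => deriv (deriv (Λ.invWP c)) w
      - invQuarticHalfDeriv c Λ.g₂ Λ.g₃ (Λ.invWP c w)) z := by
    unfold invQuarticHalfDeriv
    have := hDa.deriv
    fun_prop
  have hreg : ∀ᶠ w in 𝓝 z, w ∈ Λ.regularSet c := isOpen_regularSet.mem_nhds hz
  have hprod : ∀ᶠ w in 𝓝 z, deriv (Λ.invWP c) w * (deriv (deriv (Λ.invWP c)) w
      - invQuarticHalfDeriv c Λ.g₂ Λ.g₃ (Λ.invWP c w)) = 0 := by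
    filter_upwards [hreg.eventually_nhds] with w hw
    have hwr := hw.self_of_nhds
    have hUw := analyticAt_invWP hwr
    have h1 := (hUw.deriv.differentiableAt.hasDerivAt).pow 2
    have h2 := (hasDerivAt_invQuartic c Λ.g₂ Λ.g₃ (Λ.invWP c w)).comp w
      hUw.differentiableAt.hasDerivAt
    have h3 := (h1.congr_of_eventuallyEq
      (hw.mono fun v hv => (deriv_invWP_sq hv).symm : _ =ᶠ[𝓝 w] _)).unique h2
    simp only [Nat.cast_ofNat, Nat.add_one_sub_one, pow_one] at h3
    linear_combination h3 / 2
  have hG0 : ∀ᶠ w in 𝓝[≠] z, deriv (deriv (Λ.invWP c)) w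
      - invQuarticHalfDeriv c Λ.g₂ Λ.g₃ (Λ.invWP c w) = 0 := by
    rcases hDa.eventually_eq_zero_or_eventually_ne_zero with h | h
    · exact absurd h (not_eventually_deriv_invWP_eq_zero hz)
    · filter_upwards [h, hprod.filter_mono nhdsWithin_le_nhds] with w hw hw'
      exact (mul_eq_zero.1 hw').resolve_left hw
  have := tendsto_nhds_unique_of_eventuallyEq
    (hG.continuousAt.tendsto.mono_left nhdsWithin_le_nhds) tendsto_const_nhds hG0
  exact sub_eq_zero.1 this

/-- The function `1 / (℘ - c)` is unbounded along every filter that tends to one of its poles. -/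
lemma mem_regularSet_of_tendsto {ι : Type*} {f : Filter ι} [f.NeBot] {w : ι → ℂ} {a : ℂ}
    (hw : Tendsto w f (𝓝 z)) (hreg : ∀ᶠ i in f, w i ∈ Λ.regularSet c)
    (ha : Tendsto (fun i => Λ.invWP c (w i)) f (𝓝 a)) : z ∈ Λ.regularSet c := by
  by_contra hz
  obtain ⟨hl, hc⟩ : z ∉ Λ.lattice ∧ Λ.weierstrassP z = c := by
    simpa [regularSet] using hz
  have h1 : ∀ᶠ i in f, (Λ.weierstrassP (w i) - c) * Λ.invWP c (w i) = 1 := by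
    filter_upwards [hreg, hw.eventually (eventually_notMem_lattice hl)] with i hi hil
    rw [invWP_of_notMem hil, mul_one_div, div_self (sub_ne_zero.2 (hi.resolve_left hil))]
  have h2 := (((analyticAt_weierstrassP hl).continuousAt.tendsto.comp hw).sub_const c).mul ha
  rw [hc, sub_self, zero_mul] at h2
  exact zero_ne_one (tendsto_nhds_unique_of_eventuallyEq h2 tendsto_const_nhds h1)

end PeriodPair

/-! ### Uniqueness for second order equations and the principal root on the real line -/

/-- Local uniqueness for the autonomous second order equation `u'' = F u`. -/
lemma eventuallyEq_of_second_order_ode {F : ℂ → ℂ} (hF : ContDiff ℂ 1 F) {f f' g g' : ℝ → ℂ}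
    {t₀ : ℝ} (hf : ∀ᶠ t in 𝓝 t₀, HasDerivAt f (f' t) t ∧ HasDerivAt f' (F (f t)) t)
    (hg : ∀ᶠ t in 𝓝 t₀, HasDerivAt g (g' t) t ∧ HasDerivAt g' (F (g t)) t)
    (h : f t₀ = g t₀) (h' : f' t₀ = g' t₀) : f =ᶠ[𝓝 t₀] g ∧ f' =ᶠ[𝓝 t₀] g' := by
  set v : ℂ × ℂ → ℂ × ℂ := fun p => (p.2, F p.1) with hv
  have hvc : ContDiff ℂ 1 v := contDiff_snd.prodMk (hF.comp contDiff_fst)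
  obtain ⟨K, s, hs, hK⟩ := (hvc.contDiffAt (x := (f t₀, f' t₀))).exists_lipschitzOnWith
  have step : ∀ {f f' : ℝ → ℂ}, s ∈ 𝓝 (f t₀, f' t₀) →
      (∀ᶠ t in 𝓝 t₀, HasDerivAt f (f' t) t ∧ HasDerivAt f' (F (f t)) t) →
      ∀ᶠ t in 𝓝 t₀, HasDerivAt (fun t => (f t, f' t)) (v (f t, f' t)) t ∧ (f t, f' t) ∈ s := by
    intro f f' hs hf
    have hc : ContinuousAt (fun t => (f t, f' t)) t₀ :=
      hf.self_of_nhds.1.continuousAt.prodMk hf.self_of_nhds.2.continuousAt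
    filter_upwards [hf, hc.eventually hs] with t ht hts
    exact ⟨ht.1.prodMk ht.2, hts⟩
  have key := ODE_solution_unique_of_eventually (v := fun _ => v) (s := fun _ => s) (K := K)
    (Eventually.of_forall fun _ => hK) (step hs hf) (step (by rwa [← h, ← h']) hg)
    (by rw [h, h'])
  exact ⟨key.mono fun t ht => congrArg Prod.fst ht, key.mono fun t ht => congrArg Prod.snd ht⟩

/-- The principal complex square root of a real number. -/
noncomputable def principalSqrt (x : ℝ) : ℂ := (x : ℂ) ^ (1 / 2 : ℂ)

lemma principalSqrt_of_nonneg {x : ℝ} (hx : 0 ≤ x) : principalSqrt x = √x := by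
  rw [principalSqrt, Real.sqrt_eq_rpow, Complex.ofReal_cpow hx]
  norm_num

lemma principalSqrt_of_nonpos {x : ℝ} (hx : x ≤ 0) : principalSqrt x = Complex.I * √(-x) := by
  rw [← principalSqrt_of_nonneg (neg_nonneg.2 hx), principalSqrt, principalSqrt,
    Complex.ofReal_cpow_of_nonpos hx, mul_comm, Complex.ofReal_neg]
  congr 1
  rw [show (Real.pi : ℂ) * Complex.I * (1 / 2) = Real.pi / 2 * Complex.I by ring,
    Complex.exp_pi_div_two_mul_I]

lemma principalSqrt_eq (x : ℝ) : principalSqrt x = √x + Complex.I * √(-x) := by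
  rcases le_total 0 x with hx | hx
  · simp [principalSqrt_of_nonneg hx, Real.sqrt_eq_zero_of_nonpos (neg_nonpos.2 hx)]
  · simp [principalSqrt_of_nonpos hx, Real.sqrt_eq_zero_of_nonpos hx]

/-- The branch cut does no harm on the real line: negative numbers all get the value from the upper
side of the cut. -/
lemma continuous_principalSqrt : Continuous principalSqrt := by
  rw [funext principalSqrt_eq]
  fun_prop

lemma principalSqrt_sq (x : ℝ) : principalSqrt x ^ 2 = x := by
  rw [principalSqrt, ← Complex.cpow_nat_mul]
  norm_num

lemma principalSqrt_eq_zero {x : ℝ} : principalSqrt x = 0 ↔ x = 0 := by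
  rw [← sq_eq_zero_iff, principalSqrt_sq, Complex.ofReal_eq_zero]

lemma norm_principalSqrt (x : ℝ) : ‖principalSqrt x‖ = √|x| := by
  rw [eq_comm, Real.sqrt_eq_iff_mul_self_eq (abs_nonneg _) (norm_nonneg _), ← sq, ← norm_pow,
    principalSqrt_sq, Complex.norm_real, Real.norm_eq_abs]

lemma principalSqrt_sq_mul {a : ℝ} (ha : 0 ≤ a) (x : ℝ) :
    principalSqrt (a ^ 2 * x) = a * principalSqrt x := by
  rw [principalSqrt_eq, principalSqrt_eq, Real.sqrt_mul (sq_nonneg a), ← mul_neg,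
    Real.sqrt_mul (sq_nonneg a), Real.sqrt_sq ha]
  push_cast
  ring

/-- A fourth root of unity that turns the principal square root into a real one, for all real
numbers of the sign of `a`. -/
lemma exists_rotation_principalSqrt {a : ℝ} (ha : a ≠ 0) :
    ∃ (s : ℝ) (η : ℂ), η ^ 2 = s ∧ s ^ 2 = 1 ∧ 0 < s * a ∧
      ∀ x, 0 ≤ s * x → principalSqrt x = η * √(s * x) := by
  rcases ha.lt_or_gt with ha | ha
  · refine ⟨-1, Complex.I, by simp, by norm_num, by linarith, fun x hx => ?_⟩
    rw [principalSqrt_of_nonpos (by linarith), neg_one_mul]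
  · refine ⟨1, 1, by simp, by norm_num, by linarith, fun x hx => ?_⟩
    rw [principalSqrt_of_nonneg (by linarith), one_mul, one_mul]

lemma ofReal_invQuartic (c g₂ g₃ u : ℝ) :
    ((invQuartic c g₂ g₃ u : ℝ) : ℂ) = invQuartic (c : ℂ) g₂ g₃ u := by
  simp [invQuartic]

lemma ofReal_invQuarticHalfDeriv (c g₂ g₃ u : ℝ) :
    ((invQuarticHalfDeriv c g₂ g₃ u : ℝ) : ℂ) = invQuarticHalfDeriv (c : ℂ) g₂ g₃ u := by
  simp [invQuarticHalfDeriv]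

lemma conj_invQuarticHalfDeriv (c g₂ g₃ : ℝ) (u : ℂ) :
    starRingEnd ℂ (invQuarticHalfDeriv (c : ℂ) g₂ g₃ u) =
      invQuarticHalfDeriv (c : ℂ) g₂ g₃ (starRingEnd ℂ u) := by
  simp [invQuarticHalfDeriv, map_div₀, Complex.conj_ofNat]

lemma eventually_pos_nhdsGT_of_hasDerivAt {f : ℝ → ℝ} {d a : ℝ} (hf : HasDerivAt f d a)
    (h0 : f a = 0) (hd : 0 < d) : ∀ᶠ t in 𝓝[>] a, 0 < f t := by
  have h := (hasDerivAt_iff_tendsto_slope.1 hf).eventually (lt_mem_nhds hd)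
  filter_upwards [h.filter_mono (nhdsWithin_mono a fun t (ht : a < t) => ne_of_gt ht),
    self_mem_nhdsWithin] with t ht hta
  rw [slope_def_field, h0, sub_zero] at ht
  exact (div_pos_iff_of_pos_right (sub_pos.2 hta)).1 ht

/-- Solutions with real initial data of a second order equation with real right-hand side are
real. -/
lemma eventually_conj_eq_of_second_order_ode {F : ℂ → ℂ} (hF : ContDiff ℂ 1 F)
    (hFc : ∀ u, starRingEnd ℂ (F u) = F (starRingEnd ℂ u)) {f f' : ℝ → ℂ} {t₀ : ℝ}
    (hf : ∀ᶠ t in 𝓝 t₀, HasDerivAt f (f' t) t ∧ HasDerivAt f' (F (f t)) t)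
    (h : starRingEnd ℂ (f t₀) = f t₀) (h' : starRingEnd ℂ (f' t₀) = f' t₀) :
    ∀ᶠ t in 𝓝 t₀, ((f t).re : ℂ) = f t ∧ ((f' t).re : ℂ) = f' t := by
  -- Conjugation produces another solution with the same initial data.
  have hg : ∀ᶠ t in 𝓝 t₀, HasDerivAt (fun t => starRingEnd ℂ (f t)) (starRingEnd ℂ (f' t)) t ∧
      HasDerivAt (fun t => starRingEnd ℂ (f' t)) (F (starRingEnd ℂ (f t))) t := by
    filter_upwards [hf] with t ht
    exact ⟨ht.1.star, by rw [← hFc]; exact ht.2.star⟩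
  obtain ⟨h1, h2⟩ := eventuallyEq_of_second_order_ode hF hg hf h h'
  filter_upwards [h1, h2] with t h1 h2
  exact ⟨Complex.conj_eq_iff_re.1 h1, Complex.conj_eq_iff_re.1 h2⟩

/-! ### Inversion of the elliptic integral by continuous induction -/

namespace PeriodPair

variable {Λ : PeriodPair} {c g₂ g₃ : ℝ}

lemma hasDerivAt_invWP_comp_line {c : ℂ} {z w : ℂ} {t : ℝ} (h : z + w * t ∈ Λ.regularSet c) :
    HasDerivAt (fun t : ℝ => Λ.invWP c (z + w * t)) (w * deriv (Λ.invWP c) (z + w * t)) t ∧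
    HasDerivAt (fun t : ℝ => w * deriv (Λ.invWP c) (z + w * t))
      (w ^ 2 * invQuarticHalfDeriv c Λ.g₂ Λ.g₃ (Λ.invWP c (z + w * t))) t := by
  have hl : HasDerivAt (fun t : ℝ => z + w * t) w t := by
    simpa using ((Complex.ofRealCLM.hasDerivAt (x := t)).const_mul w).const_add z
  have hU := analyticAt_invWP h
  constructor
  · refine (hU.differentiableAt.hasDerivAt.comp t hl).congr_deriv (mul_comm _ _)
  · have h2 := hU.deriv.differentiableAt.hasDerivAt
    rw [deriv_deriv_invWP h] at h2
    refine ((h2.comp t hl).const_mul w).congr_deriv ?_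
    ring

lemma eventually_mem_regularSet_line {c : ℂ} {z w : ℂ} {t₀ : ℝ}
    (h : z + w * t₀ ∈ Λ.regularSet c) : ∀ᶠ t : ℝ in 𝓝 t₀, z + w * t ∈ Λ.regularSet c := by
  have : Continuous fun t : ℝ => z + w * t := by fun_prop
  exact this.continuousAt.eventually (isOpen_regularSet.mem_nhds h)

variable (c g₂ g₃) in
/-- The elliptic integral `∫ du / √k` from `0`, with `k` the quartic `invQuartic` and the principal
square root. -/
noncomputable def ellipticIntegral (u : ℝ) : ℂ :=
  ∫ v in (0 : ℝ)..u, 1 / principalSqrt (invQuartic c g₂ g₃ v)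

variable (Λ c g₂ g₃) in
/-- The elliptic integral inverts `1 / (℘ - c)` at `u`, with the matching sign of the derivative. -/
def InvertsAt (u : ℝ) : Prop :=
  ellipticIntegral c g₂ g₃ u ∈ Λ.regularSet c ∧
    Λ.invWP c (ellipticIntegral c g₂ g₃ u) = u ∧
    deriv (Λ.invWP c) (ellipticIntegral c g₂ g₃ u) = principalSqrt (invQuartic c g₂ g₃ u)

lemma invertsAt_zero : InvertsAt Λ c g₂ g₃ 0 := by
  have h : ellipticIntegral c g₂ g₃ 0 = 0 := intervalIntegral.integral_same
  have h0 : (0 : ℂ) ∈ Λ.lattice := Λ.lattice.zero_mem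
  refine ⟨Or.inl (by rwa [h]), by simp [h, invWP_of_mem h0], ?_⟩
  rw [h, deriv_invWP_of_mem h0, eq_comm, principalSqrt_eq_zero]
  simp [invQuartic]

lemma continuousOn_ellipticIntegral {b : ℝ} (hb : 0 ≤ b)
    (hint : IntervalIntegrable (fun u => 1 / principalSqrt (invQuartic c g₂ g₃ u)) volume 0 b) :
    ContinuousOn (ellipticIntegral c g₂ g₃) (Icc 0 b) := by
  have := intervalIntegral.continuousOn_primitive_interval (a := 0) (b := b)
    (f := fun u => 1 / principalSqrt (invQuartic c g₂ g₃ u)) (μ := volume)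
    (by rw [uIcc_of_le hb, integrableOn_Icc_iff_integrableOn_Ioc]
        exact (intervalIntegrable_iff_integrableOn_Ioc_of_le hb).1 hint)
  rwa [uIcc_of_le hb] at this

lemma continuousAt_one_div_principalSqrt {u : ℝ} (hu : invQuartic c g₂ g₃ u ≠ 0) :
    ContinuousAt (fun u => 1 / principalSqrt (invQuartic c g₂ g₃ u)) u :=
  continuousAt_const.div
    (continuous_principalSqrt.comp (continuous_invQuartic c g₂ g₃)).continuousAt
    (principalSqrt_eq_zero.not.2 hu)

lemma measurable_one_div_principalSqrt :
    Measurable fun u => 1 / principalSqrt (invQuartic c g₂ g₃ u) :=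
  (continuous_principalSqrt.comp (continuous_invQuartic c g₂ g₃)).measurable.const_div 1

lemma hasDerivAt_ellipticIntegral {b u : ℝ}
    (hint : IntervalIntegrable (fun u => 1 / principalSqrt (invQuartic c g₂ g₃ u)) volume 0 b)
    (hu : u ∈ Icc 0 b) (hk : invQuartic c g₂ g₃ u ≠ 0) :
    HasDerivAt (ellipticIntegral c g₂ g₃) (1 / principalSqrt (invQuartic c g₂ g₃ u)) u := by
  refine intervalIntegral.integral_hasDerivAt_right
    (hint.mono_set ?_) measurable_one_div_principalSqrt.stronglyMeasurable.stronglyMeasurableAtFilter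
    (continuousAt_one_div_principalSqrt hk)
  rw [uIcc_of_le hu.1, uIcc_of_le (hu.1.trans hu.2)]
  exact Icc_subset_Icc_right hu.2

/-- Along a convergent sequence `1 / (℘ - c)` takes the bounded values `x n`, so the limit of the
integrals cannot be one of its poles. -/
lemma isClosed_invertsAt {b : ℝ} (hb : 0 ≤ b)
    (hint : IntervalIntegrable (fun u => 1 / principalSqrt (invQuartic c g₂ g₃ u)) volume 0 b) :
    IsClosed ({u | InvertsAt Λ c g₂ g₃ u} ∩ Icc 0 b) := by
  refine IsSeqClosed.isClosed fun x a hx ha => ?_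
  have hab : a ∈ Icc 0 b := isClosed_Icc.mem_of_tendsto ha (Eventually.of_forall fun n => (hx n).2)
  have hZ : Tendsto (fun n => ellipticIntegral c g₂ g₃ (x n)) atTop
      (𝓝 (ellipticIntegral c g₂ g₃ a)) :=
    (continuousOn_ellipticIntegral hb hint a hab).tendsto.comp
      (tendsto_nhdsWithin_iff.2 ⟨ha, Eventually.of_forall fun n => (hx n).2⟩)
  have hU : Tendsto (fun n => Λ.invWP c (ellipticIntegral c g₂ g₃ (x n))) atTop (𝓝 (a : ℂ)) := by
    simp_rw [(hx _).1.2.1]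
    exact (Complex.continuous_ofReal.tendsto a).comp ha
  have hreg := mem_regularSet_of_tendsto hZ (Eventually.of_forall fun n => (hx n).1.1) hU
  have hA := analyticAt_invWP hreg
  refine ⟨⟨hreg, tendsto_nhds_unique (hA.continuousAt.tendsto.comp hZ) hU, ?_⟩, hab⟩
  refine tendsto_nhds_unique (hA.deriv.continuousAt.tendsto.comp hZ) ?_
  simp_rw [Function.comp_def, (hx _).1.2.2]
  exact ((continuous_principalSqrt.comp (continuous_invQuartic c g₂ g₃)).tendsto a).comp ha

/-- The germ at `t = 0⁺` of `1 / (℘ - c)` along the line that follows the elliptic integral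
is real and strictly increasing. -/
lemma InvertsAt.exists_real_branch (h2 : Λ.g₂ = g₂) (h3 : Λ.g₃ = g₃) {x : ℝ}
    (hx : InvertsAt Λ c g₂ g₃ x)
    (hk : invQuartic c g₂ g₃ x = 0 → invQuarticHalfDeriv c g₂ g₃ x ≠ 0) :
    ∃ (s : ℝ) (η : ℂ) (v v' : ℝ → ℝ), η ≠ 0 ∧ s ^ 2 = 1 ∧
      (∀ y, 0 ≤ s * y → principalSqrt y = η * √(s * y)) ∧ v 0 = x ∧
      (∀ᶠ t in 𝓝 0, HasDerivAt v (v' t) t ∧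
        ellipticIntegral c g₂ g₃ x + η⁻¹ * t ∈ Λ.regularSet c ∧
        Λ.invWP c (ellipticIntegral c g₂ g₃ x + η⁻¹ * t) = v t ∧
        deriv (Λ.invWP c) (ellipticIntegral c g₂ g₃ x + η⁻¹ * t) = η * v' t ∧
        v' t ^ 2 = s * invQuartic c g₂ g₃ (v t)) ∧
      ∀ᶠ t in 𝓝[>] 0, 0 < v' t := by
  obtain ⟨hreg, hU, hU'⟩ := hx
  set z := ellipticIntegral c g₂ g₃ x with hz
  -- The sign of `a` is that of the quartic just to the right of `x`: at a root it is read off from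
  -- the derivative.
  obtain ⟨a, ha, hak⟩ : ∃ a : ℝ, a ≠ 0 ∧ ((invQuartic c g₂ g₃ x ≠ 0 ∧ a = invQuartic c g₂ g₃ x) ∨
      (invQuartic c g₂ g₃ x = 0 ∧ a = invQuarticHalfDeriv c g₂ g₃ x)) := by
    by_cases h : invQuartic c g₂ g₃ x = 0
    · exact ⟨_, hk h, Or.inr ⟨h, rfl⟩⟩
    · exact ⟨_, h, Or.inl ⟨h, rfl⟩⟩
  obtain ⟨s, η, hηs, hs, hsa, hsqrt⟩ := exists_rotation_principalSqrt ha
  have hs0 : s ≠ 0 := fun h => by simp [h] at hsa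
  have hη0 : η ≠ 0 := fun h => hs0 (by
    rw [h] at hηs; exact_mod_cast (by simpa using hηs.symm : (s : ℂ) = 0))
  have hηi : η⁻¹ ^ 2 = s := by
    rw [inv_pow, hηs]
    exact inv_eq_of_mul_eq_one_right (by rw [← sq]; exact_mod_cast hs)
  have hskx : 0 ≤ s * invQuartic c g₂ g₃ x := by
    rcases hak with ⟨-, rfl⟩ | ⟨h, -⟩
    · exact hsa.le
    · simp [h]
  set V : ℝ → ℂ := fun t => Λ.invWP c (z + η⁻¹ * t) with hV
  set V' : ℝ → ℂ := fun t => η⁻¹ * deriv (Λ.invWP c) (z + η⁻¹ * t) with hV'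
  have hregt : ∀ᶠ t : ℝ in 𝓝 0, z + η⁻¹ * t ∈ Λ.regularSet c :=
    eventually_mem_regularSet_line (by simpa using hreg)
  have hVd : ∀ᶠ t in 𝓝 0, HasDerivAt V (V' t) t ∧
      HasDerivAt V' (s * invQuarticHalfDeriv (c : ℂ) g₂ g₃ (V t)) t := by
    filter_upwards [hregt] with t ht
    have := hasDerivAt_invWP_comp_line ht
    rwa [h2, h3, hηi] at this
  have hV0 : V 0 = x := by simp [hV, hU]
  have hV'0 : V' 0 = √(s * invQuartic c g₂ g₃ x) := by
    simp only [hV', Complex.ofReal_zero, mul_zero, add_zero, hU', hsqrt _ hskx]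
    field_simp
  have hreal := eventually_conj_eq_of_second_order_ode
    (F := fun u => s * invQuarticHalfDeriv (c : ℂ) g₂ g₃ u)
    (contDiff_const.mul (contDiff_invQuarticHalfDeriv _ _ _))
    (fun u => by rw [map_mul, Complex.conj_ofReal, conj_invQuarticHalfDeriv]) hVd
    (by rw [hV0, Complex.conj_ofReal]) (by rw [hV'0, Complex.conj_ofReal])
  have hre : ∀ {f : ℝ → ℂ} {d : ℂ} {t : ℝ}, HasDerivAt f d t →
      HasDerivAt (fun t => (f t).re) d.re t := fun h =>
    Complex.reCLM.hasFDerivAt.comp_hasDerivAt _ h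
  have hv'0 : (V' 0).re = √(s * invQuartic c g₂ g₃ x) := by rw [hV'0, Complex.ofReal_re]
  refine ⟨s, η, fun t => (V t).re, fun t => (V' t).re, hη0, hs, hsqrt, by simp [hV0], ?_, ?_⟩
  · filter_upwards [hregt, hVd, hreal] with t ht hd hr
    refine ⟨hre hd.1, ht, hr.1.symm, ?_, ?_⟩
    · rw [hr.2]
      simp only [hV']
      field_simp
    · have h := deriv_invWP_sq ht
      rw [h2, h3] at h
      have : ((V' t).re : ℂ) ^ 2 = s * invQuartic (c : ℂ) g₂ g₃ ((V t).re : ℂ) := by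
        rw [hr.1, hr.2]
        simp only [hV', mul_pow, hηi, h, hV]
      rw [← ofReal_invQuartic] at this
      exact_mod_cast this
  -- Off the roots `v' 0 = √(s k(x)) > 0`; at a root `v' 0 = 0`, but `v'' 0 = s k'(x) / 2 > 0`.
  · have hd := hVd.self_of_nhds.2
    rcases hak with ⟨-, rfl⟩ | ⟨h, rfl⟩
    · refine ((hre hd).continuousAt.eventually (lt_mem_nhds ?_)).filter_mono nhdsWithin_le_nhds
      exact (Real.sqrt_pos.2 hsa).trans_eq hv'0.symm
    · refine eventually_pos_nhdsGT_of_hasDerivAt (hre hd) (by simp [hv'0, h]) ?_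
      rwa [hV0, ← ofReal_invQuarticHalfDeriv, ← Complex.ofReal_mul, Complex.ofReal_re]

/-- Along the real branch `v`, the integrand `1 / √k` at `v t` equals `1 / (η v' t)`, so the
elliptic integral at `v t` has constant speed `η⁻¹` in `t` and stays on the line on which `v` was
defined. -/
lemma InvertsAt.exists_gt (h2 : Λ.g₂ = g₂) (h3 : Λ.g₃ = g₃) {x b y : ℝ}
    (hint : IntervalIntegrable (fun u => 1 / principalSqrt (invQuartic c g₂ g₃ u)) volume 0 b)
    (hx : InvertsAt Λ c g₂ g₃ x) (hxb : x ∈ Ico 0 b) (hxy : x < y)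
    (hk : invQuartic c g₂ g₃ x = 0 → invQuarticHalfDeriv c g₂ g₃ x ≠ 0) :
    ∃ u ∈ Ioc x y, InvertsAt Λ c g₂ g₃ u := by
  obtain ⟨s, η, v, v', hη0, hs, hsqrt, hv0, hev, hpos⟩ := hx.exists_real_branch h2 h3 hk
  set z := ellipticIntegral c g₂ g₃ x with hz
  have hlt : ∀ᶠ t in 𝓝 0, v t < min y b :=
    hev.self_of_nhds.1.continuousAt.eventually
      (gt_mem_nhds (by rw [hv0]; exact lt_min hxy hxb.2))
  obtain ⟨ε, hε, hball⟩ := Metric.eventually_nhds_iff.1 (hev.and hlt)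
  obtain ⟨ε', hε', hIoo⟩ := mem_nhdsGT_iff_exists_Ioo_subset.1 hpos
  have hε'0 : (0 : ℝ) < ε' := hε'
  set T := min ε ε' / 2 with hT
  have hT0 : 0 < T := half_pos (lt_min hε hε'0)
  have hTε : T < ε := (half_lt_self (lt_min hε hε'0)).trans_le (min_le_left _ _)
  have hTε' : T < ε' := (half_lt_self (lt_min hε hε'0)).trans_le (min_le_right _ _)
  have hb : ∀ t ∈ Icc 0 T, _ := fun t ht =>
    hball (y := t) (by rw [Real.dist_eq, sub_zero, abs_of_nonneg ht.1]; exact ht.2.trans_lt hTε)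
  have hp : ∀ t ∈ Ioc 0 T, 0 < v' t := fun t ht => hIoo ⟨ht.1, ht.2.trans_lt hTε'⟩
  have hvc : ContinuousOn v (Icc 0 T) := fun t ht =>
    (hb t ht).1.1.continuousAt.continuousWithinAt
  have hmono : StrictMonoOn v (Icc 0 T) := by
    refine strictMonoOn_of_deriv_pos (convex_Icc 0 T) hvc fun t ht => ?_
    rw [interior_Icc] at ht
    rw [(hb t (Ioo_subset_Icc_self ht)).1.1.deriv]
    exact hp t (Ioo_subset_Ioc_self ht)
  have hgt : ∀ t ∈ Ioc 0 T, x < v t := fun t ht => by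
    rw [← hv0]
    exact hmono (left_mem_Icc.2 hT0.le) (Ioc_subset_Icc_self ht) ht.1
  have hmem : ∀ t ∈ Icc 0 T, v t ∈ Icc 0 b := fun t ht => by
    refine ⟨hxb.1.trans ?_, ((hb t ht).2.trans_le (min_le_right _ _)).le⟩
    rw [← hv0]
    exact hmono.monotoneOn (left_mem_Icc.2 hT0.le) ht ht.1
  have hroot : ∀ t ∈ Ioc 0 T, 0 < s * invQuartic c g₂ g₃ (v t) ∧
      principalSqrt (invQuartic c g₂ g₃ (v t)) = η * v' t := fun t ht => by
    have h1 := (hb t (Ioc_subset_Icc_self ht)).1.2.2.2.2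
    have h0 : 0 < s * invQuartic c g₂ g₃ (v t) := h1 ▸ pow_pos (hp t ht) 2
    exact ⟨h0, by rw [hsqrt _ h0.le, ← h1, Real.sqrt_sq (hp t ht).le]⟩
  have hZ : ellipticIntegral c g₂ g₃ (v T) = z + η⁻¹ * T := by
    -- Only derivatives inside `(0, T)` are used, because the integrand may blow up at `t = 0`;
    -- continuity covers the end point.
    have hconst := intervalIntegral.integral_eq_sub_of_hasDerivAt_of_le (a := 0) (b := T)
      (f := fun t : ℝ => ellipticIntegral c g₂ g₃ (v t) - η⁻¹ * t) (f' := fun _ => 0) hT0.le ?_ ?_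
      intervalIntegrable_const
    · simp only [intervalIntegral.integral_zero, hv0, Complex.ofReal_zero, mul_zero,
        sub_zero] at hconst
      linear_combination -hconst
    · exact ((continuousOn_ellipticIntegral (hxb.1.trans hxb.2.le) hint).comp hvc hmem).sub
        (by fun_prop)
    · intro t ht
      have htc := Ioo_subset_Icc_self ht
      have hto := Ioo_subset_Ioc_self ht
      have hne : invQuartic c g₂ g₃ (v t) ≠ 0 := fun h => by
        simpa [h] using (hroot t hto).1
      have h1 := (hasDerivAt_ellipticIntegral hint (hmem t htc) hne).scomp t (hb t htc).1.1
      have h2 := (Complex.ofRealCLM.hasDerivAt (x := t)).const_mul η⁻¹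
      refine (h1.sub h2).congr_deriv ?_
      have hv'0 : (v' t : ℂ) ≠ 0 := Complex.ofReal_ne_zero.2 (hp t hto).ne'
      rw [(hroot t hto).2, Complex.real_smul, Complex.ofRealCLM_apply]
      field_simp
      simp
  have hTc := right_mem_Icc.2 hT0.le
  have hTo := right_mem_Ioc.2 hT0
  obtain ⟨⟨-, h1, h2, h3, -⟩, h4⟩ := hb T hTc
  refine ⟨v T, ⟨hgt T hTo, (h4.trans_le (min_le_left _ _)).le⟩, ?_⟩
  rw [InvertsAt, hZ]
  exact ⟨h1, h2, h3.trans (hroot T hTo).2.symm⟩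

/-- The elliptic integral of the first kind with the principal square root, taken across the simple
roots of the quartic on the real line, inverts `1 / (℘ - c)`. -/
theorem invertsAt_of_mem_Icc (h2 : Λ.g₂ = g₂) (h3 : Λ.g₃ = g₃) {b : ℝ}
    (hint : IntervalIntegrable (fun u => 1 / principalSqrt (invQuartic c g₂ g₃ u)) volume 0 b)
    (hk : ∀ u, invQuartic c g₂ g₃ u = 0 → invQuarticHalfDeriv c g₂ g₃ u ≠ 0) {u : ℝ}
    (hu : u ∈ Icc 0 b) : InvertsAt Λ c g₂ g₃ u := by
  refine IsClosed.Icc_subset_of_forall_exists_gt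
    (isClosed_invertsAt (hu.1.trans hu.2) hint) invertsAt_zero (fun x hx y hy => ?_) hu
  obtain ⟨v, hv, hiv⟩ := InvertsAt.exists_gt h2 h3 hint hx.1 hx.2 hy (hk x)
  exact ⟨v, hiv, hv⟩

end PeriodPair

/-! ### Integrability of the inverse square root across simple roots -/

lemma locallyIntegrable_norm_rpow_neg_half : LocallyIntegrable fun v : ℝ => ‖v‖ ^ (-(1 / 2) : ℝ) :=
  locallyIntegrable_of_norm_le_rpow (C := 1) (α := 1 / 2) (by simp) (by norm_num)
    (Eventually.of_forall fun v => by
      rw [one_mul, Real.norm_eq_abs, abs_of_nonneg (Real.rpow_nonneg (norm_nonneg _) _)])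
    (measurable_norm.pow_const _).aestronglyMeasurable

lemma integrableAtFilter_norm_sub_rpow_neg_half (x : ℝ) :
    IntegrableAtFilter (fun v : ℝ => ‖v - x‖ ^ (-(1 / 2) : ℝ)) (𝓝 x) := by
  have h := ((locallyIntegrable_norm_rpow_neg_half.integrableOn_isCompact
    (isCompact_uIcc (a := -1) (b := 1))).intervalIntegrable).comp_sub_right x
  rw [intervalIntegrable_iff_integrableOn_Ioo_of_le (by linarith)] at h
  exact ⟨_, Ioo_mem_nhds (by linarith) (by linarith), h⟩

/-- The inverse square root of a function is integrable near a simple zero. -/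
lemma integrableAtFilter_one_div_principalSqrt {k : ℝ → ℝ} (hk : Measurable k) {x d : ℝ}
    (hd : HasDerivAt k d x) (hd0 : k x = 0 → d ≠ 0) :
    IntegrableAtFilter (fun v => 1 / principalSqrt (k v)) (𝓝 x) := by
  have hm : Measurable fun v => 1 / principalSqrt (k v) :=
    (continuous_principalSqrt.measurable.comp hk).const_div 1
  by_cases hx : k x = 0
  · have hO := (HasDerivAtFilter.isTheta_sub hd (hd0 hx)).2.comp_tendsto
      (tendsto_id.prodMk (tendsto_const_pure (b := x)))
    obtain ⟨C, hC, hO⟩ := hO.exists_pos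
    obtain ⟨s, hs, hsi⟩ := integrableAtFilter_norm_sub_rpow_neg_half x
    obtain ⟨t, ht, htm, hts⟩ : ∃ t ∈ 𝓝 x, MeasurableSet t ∧
        ∀ v ∈ t, v ∈ s ∧ ‖v - x‖ ≤ C * ‖k v - k x‖ := by
      obtain ⟨t, ht, hto, hxt⟩ := mem_nhds_iff.1 (inter_mem hs hO.bound)
      exact ⟨t, hto.mem_nhds hxt, hto.measurableSet, ht⟩
    refine ⟨t, ht, Integrable.mono' ((hsi.mono_set fun v hv => (hts v hv).1).const_mul √C)
      hm.aestronglyMeasurable ((ae_restrict_iff' htm).2 (Eventually.of_forall fun v hv => ?_))⟩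
    have h := (hts v hv).2
    rw [hx, sub_zero, Real.norm_eq_abs (k v)] at h
    rw [norm_div, norm_one, norm_principalSqrt, Real.rpow_neg (norm_nonneg _), ← Real.sqrt_eq_rpow]
    -- At the root itself both sides are `0`, since `1 / 0 = 0`.
    rcases (norm_nonneg (v - x)).eq_or_lt with h0 | h0
    · have : v = x := sub_eq_zero.1 (norm_eq_zero.1 h0.symm)
      simp [this, hx]
    · have hkv : 0 < |k v| := pos_of_mul_pos_right (h0.trans_le h) hC.le
      rw [← div_eq_mul_inv, div_le_div_iff₀ (Real.sqrt_pos.2 hkv) (Real.sqrt_pos.2 h0), one_mul,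
        ← Real.sqrt_mul hC.le]
      exact Real.sqrt_le_sqrt h
  · have hc : ContinuousAt (fun v => 1 / principalSqrt (k v)) x :=
      continuousAt_const.div (continuous_principalSqrt.continuousAt.comp hd.continuousAt)
        (principalSqrt_eq_zero.not.2 hx)
    exact hc.tendsto.integrableAtFilter hm.stronglyMeasurable.stronglyMeasurableAtFilter
      (volume.finiteAt_nhds x)

lemma intervalIntegrable_one_div_principalSqrt {k k' : ℝ → ℝ} (hk : ∀ x, HasDerivAt k (k' x) x)
    (hk' : ∀ x, k x = 0 → k' x ≠ 0) (a b : ℝ) :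
    IntervalIntegrable (fun v => 1 / principalSqrt (k v)) volume a b := by
  have hc : Continuous k := continuous_iff_continuousAt.2 fun x => (hk x).continuousAt
  have : LocallyIntegrable (fun v => 1 / principalSqrt (k v)) := fun x =>
    integrableAtFilter_one_div_principalSqrt hc.measurable (hk x) (hk' x)
  exact (this.integrableOn_isCompact isCompact_uIcc).intervalIntegrable

lemma invQuartic_eq_pow_mul {A : Type*} [Field A] (c g₂ g₃ : A) {u : A} (hu : u ≠ 0) :
    invQuartic c g₂ g₃ u =
      (u ^ 2) ^ 2 * (4 * (c + 1 / u) ^ 3 - g₂ * (c + 1 / u) - g₃) := by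
  rw [invQuartic]
  field_simp
  ring

/-- A double root `u` is nonzero, as the half derivative at `0` is `2`, so `s = c + 1 / u` is a
double root of the cubic. Then `g₂ = 12 s²` and `g₃ = -8 s³`, which kills the discriminant. -/
lemma invQuarticHalfDeriv_ne_zero {A : Type*} [Field A] [CharZero A] {c g₂ g₃ : A}
    (hdisc : g₂ ^ 3 - 27 * g₃ ^ 2 ≠ 0) {u : A} (hu : invQuartic c g₂ g₃ u = 0) :
    invQuarticHalfDeriv c g₂ g₃ u ≠ 0 := by
  intro hF
  by_cases hu0 : u = 0
  · simp [hu0, invQuarticHalfDeriv] at hF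
  set s := c + 1 / u with hs
  have hp : 4 * s ^ 3 - g₂ * s - g₃ = 0 := by
    rw [invQuartic_eq_pow_mul c g₂ g₃ hu0] at hu
    exact (mul_eq_zero.1 hu).resolve_left (by positivity)
  have hp' : 12 * s ^ 2 - g₂ = 0 := by
    have h : u ^ 2 * (12 * s ^ 2 - g₂) =
        4 * u ^ 3 * (4 * s ^ 3 - g₂ * s - g₃) - 2 * invQuarticHalfDeriv c g₂ g₃ u := by
      rw [hs, invQuarticHalfDeriv]
      field_simp
      ring
    rw [hp, hF, mul_zero, mul_zero, sub_zero] at h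
    exact (mul_eq_zero.1 h).resolve_left (by positivity)
  refine hdisc ?_
  have h2 : g₂ = 12 * s ^ 2 := by linear_combination -hp'
  have h3 : g₃ = -8 * s ^ 3 := by rw [h2] at hp; linear_combination -hp
  rw [h2, h3]
  ring

/-! ### Carlson's integral as an inverse of `℘` -/

lemma image_one_div_one_add_Ioi : (fun ζ : ℝ => 1 / (1 + ζ)) '' Ioi 0 = Ioo 0 1 := by
  ext u
  simp only [mem_image, mem_Ioi, mem_Ioo]
  constructor
  · rintro ⟨ζ, hζ, rfl⟩
    exact ⟨by positivity, by rw [div_lt_one (by linarith)]; linarith⟩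
  · rintro ⟨h0, h1⟩
    refine ⟨1 / u - 1, ?_, by simp⟩
    rw [sub_pos, lt_div_iff₀ h0]
    linarith

lemma hasDerivAt_one_div_one_add {ζ : ℝ} (hζ : 0 < ζ) :
    HasDerivAt (fun ζ : ℝ => 1 / (1 + ζ)) (-(1 / (1 + ζ)) ^ 2) ζ := by
  have h := ((hasDerivAt_id ζ).const_add 1).inv (by simp; linarith)
  simp only [one_div]
  exact h.congr_deriv (by simp [neg_div])

namespace RNdS

variable {g₂ g₃ wp₀ : ℝ} {z₁ z₂ z₃ : ℂ}

/-- With `u = 1 / (1 + ζ)` and `c = wp₀ - 1` one has `c + 1 / u = wp₀ + ζ`. The product under the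
root is real even if the `zᵢ` are not, and the factors `u⁴` and `1 / 4` are squares of nonnegative
reals, so they leave the principal root. The absolute value is the Jacobian. -/
lemma carlsonIntegrand_eq
    (hz : ∀ s : ℂ, 4 * s ^ 3 - g₂ * s - g₃ = 4 * ((s - z₁) * (s - z₂) * (s - z₃))) {ζ : ℝ}
    (hζ : 0 < ζ) :
    carlsonIntegrand (wp₀ - z₁) (wp₀ - z₂) (wp₀ - z₃) ζ =
      2 * (|-(1 / (1 + ζ)) ^ 2| •
        (1 / principalSqrt (invQuartic (wp₀ - 1) g₂ g₃ (1 / (1 + ζ))))) := by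
  have hu : 0 < 1 / (1 + ζ) := by positivity
  have hs : wp₀ - 1 + 1 / (1 / (1 + ζ)) = wp₀ + ζ := by rw [one_div_one_div]; ring
  have hprod : ((ζ : ℂ) + (wp₀ - z₁)) * (ζ + (wp₀ - z₂)) * (ζ + (wp₀ - z₃)) =
      (((1 / 2) ^ 2 * (4 * (wp₀ + ζ) ^ 3 - g₂ * (wp₀ + ζ) - g₃) : ℝ) : ℂ) := by
    have := hz (wp₀ + ζ)
    push_cast
    linear_combination -this / 4
  rw [invQuartic_eq_pow_mul _ _ _ hu.ne', hs, principalSqrt_sq_mul (sq_nonneg _), abs_neg,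
    abs_of_nonneg (sq_nonneg _), Complex.real_smul, carlsonIntegrand, hprod, ← principalSqrt,
    principalSqrt_sq_mul (by norm_num)]
  have h0 : (((1 / (1 + ζ)) ^ 2 : ℝ) : ℂ) ≠ 0 := Complex.ofReal_ne_zero.2 (by positivity)
  rw [mul_one_div, div_mul_cancel_left₀ h0, one_div, mul_inv]
  norm_num

lemma integrableOn_carlsonIntegrand (hdisc : g₂ ^ 3 - 27 * g₃ ^ 2 ≠ 0)
    (hz : ∀ s : ℂ, 4 * s ^ 3 - g₂ * s - g₃ = 4 * ((s - z₁) * (s - z₂) * (s - z₃))) :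
    IntegrableOn (carlsonIntegrand (wp₀ - z₁) (wp₀ - z₂) (wp₀ - z₃)) (Ioi 0) ∧
      carlsonRF (wp₀ - z₁) (wp₀ - z₂) (wp₀ - z₃) =
        PeriodPair.ellipticIntegral (wp₀ - 1) g₂ g₃ 1 := by
  have hint := intervalIntegrable_one_div_principalSqrt (hasDerivAt_invQuartic (wp₀ - 1) g₂ g₃)
    (fun x hx => mul_ne_zero two_ne_zero (invQuarticHalfDeriv_ne_zero hdisc hx)) 0 1
  have hderiv : ∀ ζ ∈ Ioi (0 : ℝ), HasDerivWithinAt (fun ζ : ℝ => 1 / (1 + ζ))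
      (-(1 / (1 + ζ)) ^ 2) (Ioi 0) ζ := fun ζ hζ =>
    (hasDerivAt_one_div_one_add hζ).hasDerivWithinAt
  have hinj : InjOn (fun ζ : ℝ => 1 / (1 + ζ)) (Ioi 0) := fun x _ y _ h => by simpa using h
  have heq : EqOn (carlsonIntegrand (wp₀ - z₁) (wp₀ - z₂) (wp₀ - z₃)) _ (Ioi 0) :=
    fun ζ hζ => carlsonIntegrand_eq hz hζ
  constructor
  · rw [integrableOn_congr_fun heq measurableSet_Ioi]
    refine Integrable.const_mul ?_ 2
    have := (integrableOn_image_iff_integrableOn_abs_deriv_smul measurableSet_Ioi hderiv hinj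
      fun u => 1 / principalSqrt (invQuartic (wp₀ - 1) g₂ g₃ u)).1
    rw [image_one_div_one_add_Ioi] at this
    exact this ((intervalIntegrable_iff_integrableOn_Ioo_of_le zero_le_one).1 hint)
  · rw [carlsonRF, setIntegral_congr_fun measurableSet_Ioi heq, integral_const_mul,
      ← integral_image_eq_integral_abs_deriv_smul measurableSet_Ioi hderiv hinj
        fun u => 1 / principalSqrt (invQuartic (wp₀ - 1) g₂ g₃ u), image_one_div_one_add_Ioi,
      PeriodPair.ellipticIntegral, intervalIntegral.integral_of_le zero_le_one,
      integral_Ioc_eq_integral_Ioo]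
    ring

/-- The Carlson integral with the principal square root inverts `℘` at every real value. -/
theorem weierstrassP_carlsonRF {Λ : PeriodPair} (h2 : Λ.g₂ = g₂) (h3 : Λ.g₃ = g₃)
    (hdisc : g₂ ^ 3 - 27 * g₃ ^ 2 ≠ 0)
    (hz : ∀ s : ℂ, 4 * s ^ 3 - g₂ * s - g₃ = 4 * ((s - z₁) * (s - z₂) * (s - z₃))) :
    carlsonRF (wp₀ - z₁) (wp₀ - z₂) (wp₀ - z₃) ∉ Λ.lattice ∧
    Λ.weierstrassP (carlsonRF (wp₀ - z₁) (wp₀ - z₂) (wp₀ - z₃)) = wp₀ ∧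
    Λ.derivWeierstrassP (carlsonRF (wp₀ - z₁) (wp₀ - z₂) (wp₀ - z₃)) =
      -principalSqrt (4 * wp₀ ^ 3 - g₂ * wp₀ - g₃) := by
  have hint := intervalIntegrable_one_div_principalSqrt (hasDerivAt_invQuartic (wp₀ - 1) g₂ g₃)
    (fun x hx => mul_ne_zero two_ne_zero (invQuarticHalfDeriv_ne_zero hdisc hx)) 0 1
  rw [(integrableOn_carlsonIntegrand hdisc hz).2]
  -- The upper limit `u = 1` is `ζ = 0`; there `1 / (℘ - c) = 1`, that is `℘ = c + 1 = wp₀`, and the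
  -- derivative of `1 / (℘ - c)` is `-℘'`.
  obtain ⟨hreg, hU, hU'⟩ := PeriodPair.invertsAt_of_mem_Icc h2 h3 hint
    (fun u => invQuarticHalfDeriv_ne_zero hdisc) (right_mem_Icc.2 zero_le_one)
  set z := PeriodPair.ellipticIntegral (wp₀ - 1) g₂ g₃ 1
  have hl : z ∉ Λ.lattice := fun h => by
    rw [PeriodPair.invWP_of_mem h] at hU
    simp at hU
  have hP : Λ.weierstrassP z - (wp₀ - 1 : ℝ) = 1 := by
    rw [PeriodPair.invWP_of_notMem hl, Complex.ofReal_one] at hU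
    exact (div_eq_one_iff_eq (fun h => zero_ne_one (by rw [← hU, h, div_zero]))).1 hU |>.symm
  rw [PeriodPair.deriv_invWP_of_notMem hl (hreg.resolve_left hl), hP, one_pow, div_one,
    invQuartic_eq_pow_mul _ _ _ one_ne_zero] at hU'
  refine ⟨hl, ?_, ?_⟩
  · push_cast at hP
    linear_combination hP
  · rw [← neg_eq_iff_eq_neg, hU']
    norm_num

end RNdS

/-! ### Equatorial null geodesics and their orbit equations -/

namespace RNdS

variable {lam M Q E L : ℝ}

/-- The derivative of `horizonFn`. -/
noncomputable def horizonFnDeriv (lam M Q r : ℝ) : ℝ :=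
  -(2 * lam * r) + 2 * M / r ^ 2 - 2 * Q ^ 2 / r ^ 3

lemma hasDerivAt_horizonFn (lam M Q : ℝ) {r : ℝ} (hr : r ≠ 0) :
    HasDerivAt (horizonFn lam M Q) (horizonFnDeriv lam M Q r) r := by
  have hid := hasDerivAt_id r
  have h := ((((hid.pow 2).const_mul lam).const_sub 1).sub
    ((hasDerivAt_const r (2 * M)).div hid hr)).add
    ((hasDerivAt_const r (Q ^ 2)).div (hid.pow 2) (pow_ne_zero 2 hr))
  refine h.congr_deriv ?_
  simp only [id, horizonFnDeriv, Pi.pow_apply]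
  field_simp
  ring

/-- The inverse metric. -/
noncomputable def invMetric (lam M Q : ℝ) : Patch → (Fin 4 → ℝ) → Matrix (Fin 4) (Fin 4) ℝ
  | .static, x =>
      !![-1 / horizonFn lam M Q (x 1), 0, 0, 0;
         0, horizonFn lam M Q (x 1), 0, 0;
         0, 0, 1 / x 1 ^ 2, 0;
         0, 0, 0, 1 / (x 1 ^ 2 * Real.sin (x 2) ^ 2)]
  | .ingoing, x =>
      !![0, 1, 0, 0;
         1, horizonFn lam M Q (x 1), 0, 0;
         0, 0, 1 / x 1 ^ 2, 0;
         0, 0, 0, 1 / (x 1 ^ 2 * Real.sin (x 2) ^ 2)]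
  | .outgoing, x =>
      !![0, -1, 0, 0;
         -1, horizonFn lam M Q (x 1), 0, 0;
         0, 0, 1 / x 1 ^ 2, 0;
         0, 0, 0, 1 / (x 1 ^ 2 * Real.sin (x 2) ^ 2)]

lemma inv_metric {p : Patch} {x : Fin 4 → ℝ} (hx : x ∈ domain lam M Q p) :
    (metric lam M Q p x)⁻¹ = invMetric lam M Q p x := by
  apply Matrix.inv_eq_right_inv
  cases p
  · obtain ⟨h1, h2, h3⟩ := hx
    ext i j
    fin_cases i <;> fin_cases j <;>
      simp [metric, invMetric, Matrix.mul_apply, Fin.sum_univ_four, h1, h3] <;> field_simp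
  all_goals
    obtain ⟨h1, h2⟩ := hx
    ext i j
    fin_cases i <;> fin_cases j <;>
      simp [metric, invMetric, Matrix.mul_apply, Fin.sum_univ_four, h1] <;> field_simp

lemma pderiv_metric_zero (p : Patch) (x : Fin 4 → ℝ) (μ ν : Fin 4) :
    pderiv (fun y => metric lam M Q p y μ ν) 0 x = 0 := by
  cases p <;> simp [pderiv, metric, Function.update_of_ne]

lemma pderiv_metric_three (p : Patch) (x : Fin 4 → ℝ) (μ ν : Fin 4) :
    pderiv (fun y => metric lam M Q p y μ ν) 3 x = 0 := by
  cases p <;> simp [pderiv, metric, Function.update_of_ne]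

/-- The radial derivative of the metric. -/
noncomputable def metricRadialDeriv (lam M Q : ℝ) :
    Patch → (Fin 4 → ℝ) → Matrix (Fin 4) (Fin 4) ℝ
  | .static, x =>
      !![-horizonFnDeriv lam M Q (x 1), 0, 0, 0;
         0, -horizonFnDeriv lam M Q (x 1) / horizonFn lam M Q (x 1) ^ 2, 0, 0;
         0, 0, 2 * x 1, 0;
         0, 0, 0, 2 * x 1 * Real.sin (x 2) ^ 2]
  | _, x =>
      !![-horizonFnDeriv lam M Q (x 1), 0, 0, 0;
         0, 0, 0, 0;
         0, 0, 2 * x 1, 0;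
         0, 0, 0, 2 * x 1 * Real.sin (x 2) ^ 2]

lemma pderiv_metric_one {p : Patch} {x : Fin 4 → ℝ} (hx : x ∈ domain lam M Q p) (μ ν : Fin 4) :
    pderiv (fun y => metric lam M Q p y μ ν) 1 x = metricRadialDeriv lam M Q p x μ ν := by
  have h1 : x 1 ≠ 0 := by cases p <;> exact hx.1
  have hΔ := (hasDerivAt_horizonFn lam M Q h1)
  have hΔ' := hΔ.deriv
  cases p
  · have hinv := (hΔ.inv hx.2.2).deriv
    fin_cases μ <;> fin_cases ν <;>
      simp [pderiv, metric, metricRadialDeriv, Function.update_of_ne, hΔ', ← hinv]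
    rfl
  all_goals
    fin_cases μ <;> fin_cases ν <;>
      simp [pderiv, metric, metricRadialDeriv, Function.update_of_ne, hΔ']

end RNdS

namespace RNdS

variable {lam M Q E L : ℝ}

/-- The radial Christoffel symbols, contracted with an equatorial velocity. -/
lemma sum_christoffel_radial {p : Patch} {x : Fin 4 → ℝ} (hx : x ∈ domain lam M Q p)
    (hx2 : x 2 = Real.pi / 2) {v : Fin 4 → ℝ} (hv : v 2 = 0) :
    ∑ α, ∑ β, christoffel (metric lam M Q p) 1 α β x * v α * v β =
      -horizonFnDeriv lam M Q (x 1) / 2 * (∑ μ, (∑ ν, metric lam M Q p x μ ν * v ν) * v μ)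
        + horizonFnDeriv lam M Q (x 1) / 2 * (x 1 ^ 2 * v 3 ^ 2)
        - x 1 * horizonFn lam M Q (x 1) * v 3 ^ 2 := by
  have hsin : Real.sin (x 2) = 1 := by rw [hx2, Real.sin_pi_div_two]
  simp only [christoffel, Fin.sum_univ_four, hv, mul_zero, zero_mul, add_zero, zero_add,
    inv_metric hx, pderiv_metric_zero, pderiv_metric_three, pderiv_metric_one hx]
  cases p
  · have h3 := hx.2.2
    simp [hsin, invMetric, metricRadialDeriv, metric]
    field_simp
    ring
  all_goals
    simp [hsin, invMetric, metricRadialDeriv, metric]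
    ring

/-- The first integrals of equatorial null geodesics and the radial potential. -/
lemma radial_energy_eq {p : Patch} {x : Fin 4 → ℝ} (hx : x ∈ domain lam M Q p)
    (hx2 : x 2 = Real.pi / 2) {v : Fin 4 → ℝ} (hv : v 2 = 0)
    (hnull : ∑ μ, (∑ ν, metric lam M Q p x μ ν * v ν) * v μ = 0)
    (hE : -∑ ν, metric lam M Q p x 0 ν * v ν = E) (hL : ∑ ν, metric lam M Q p x 3 ν * v ν = L) :
    v 3 * x 1 ^ 2 = L ∧ v 1 ^ 2 = E ^ 2 - horizonFn lam M Q (x 1) * (L ^ 2 / x 1 ^ 2) := by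
  have hsin : Real.sin (x 2) = 1 := by rw [hx2, Real.sin_pi_div_two]
  have hr : x 1 ≠ 0 := by cases p <;> exact hx.1
  cases p
  · have h3 := hx.2.2
    simp [Fin.sum_univ_four, hv, hsin, metric] at hnull hE hL
    refine ⟨by linarith, ?_⟩
    rw [← hL, ← hE]
    field_simp at hnull ⊢
    linear_combination hnull
  all_goals
    simp [Fin.sum_univ_four, hv, hsin, metric] at hnull hE hL
    refine ⟨by linarith, ?_⟩
    rw [← hL, ← hE]
    field_simp
    linear_combination horizonFn lam M Q (x 1) * hnull

/-- The radial and azimuthal equations of motion at the parameter `l`. -/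
structure RadialMotionAt (lam M Q E L : ℝ) (r φ : ℝ → ℝ) (l : ℝ) : Prop where
  ne_zero : r l ≠ 0
  contDiffAt_radius : ContDiffAt ℝ 2 r l
  contDiffAt_azimuth : ContDiffAt ℝ 2 φ l
  azimuth : deriv φ l * r l ^ 2 = L
  energy : deriv r l ^ 2 = E ^ 2 - horizonFn lam M Q (r l) * (L ^ 2 / r l ^ 2)
  radius : deriv (deriv r) l = r l * horizonFn lam M Q (r l) * deriv φ l ^ 2
    - horizonFnDeriv lam M Q (r l) / 2 * (r l ^ 2 * deriv φ l ^ 2)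

lemma IsEquatorialNullGeodesic.radialMotionAt {I : Set ℝ} {r φ : ℝ → ℝ}
    (h : IsEquatorialNullGeodesic lam M Q E L I r φ) {l : ℝ} (hl : l ∈ I) :
    RadialMotionAt lam M Q E L r φ l := by
  obtain ⟨p, w, J, hJ, hlJ, -, hgeo, hcons⟩ := h.exists_patch l hl
  set c : ℝ → Fin 4 → ℝ := fun l => ![w l, r l, Real.pi / 2, φ l] with hc
  have hx := hgeo.mem l hlJ
  have hx2 : c l 2 = Real.pi / 2 := rfl
  have hv : (fun μ => velocity c μ l) 2 = 0 := deriv_const l (Real.pi / 2)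
  obtain ⟨hnull, hE, hL⟩ := hcons l hlJ
  obtain ⟨h1, h2⟩ := radial_energy_eq hx hx2 (v := fun μ => velocity c μ l) hv hnull hE hL
  have hdiff : ∀ μ, ContDiffAt ℝ 2 (fun s => c s μ) l := fun μ =>
    contDiffAt_pi.1 (hgeo.contDiffOn.contDiffAt (hJ.mem_nhds hlJ)) μ
  have hacc := hgeo.geodesic_eq l hlJ 1
  have hsum := sum_christoffel_radial hx hx2 (v := fun μ => velocity c μ l) hv
  have hnull' : ∑ μ, (∑ ν, metric lam M Q p (c l) μ ν * velocity c ν l) * velocity c μ l = 0 :=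
    hnull
  -- Nullity removes the only term with the time velocity, which makes the radial equation the same
  -- in every patch.
  simp only [hnull', mul_zero, zero_add] at hsum
  rw [hsum] at hacc
  refine ⟨?_, hdiff 1, hdiff 3, h1, h2, ?_⟩
  · cases p <;> exact hx.1
  · have : deriv (deriv r) l + (horizonFnDeriv lam M Q (r l) / 2 * (r l ^ 2 * deriv φ l ^ 2)
        - r l * horizonFn lam M Q (r l) * deriv φ l ^ 2) = 0 := hacc
    linarith

/-- A function of the polar angle along a curve is differentiable where the angle is a regular
parameter. -/
lemma hasDerivAt_of_comp_eq {I : Set ℝ} (hI : IsOpen I) {φ f R : ℝ → ℝ} {l d : ℝ} (hl : l ∈ I)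
    (hφ : ContDiffAt ℝ 2 φ l) (hφ0 : deriv φ l ≠ 0) (hf : HasDerivAt f d l)
    (hR : ∀ m ∈ I, R (φ m) = f m) : HasDerivAt R (d / deriv φ l) (φ l) := by
  have hs : HasStrictDerivAt φ (deriv φ l) l := hφ.hasStrictDerivAt (by norm_num)
  set g := hs.localInverse φ (deriv φ l) l hφ0 with hg
  have hgd : HasDerivAt g (deriv φ l)⁻¹ (φ l) := (hs.to_localInverse hφ0).hasDerivAt
  have hgl : g (φ l) = l := (hs.hasStrictFDerivAt_equiv hφ0).localInverse_apply_image
  have hright : ∀ᶠ x in 𝓝 (φ l), φ (g x) = x :=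
    (hs.hasStrictFDerivAt_equiv hφ0).eventually_right_inverse
  have hmem : ∀ᶠ x in 𝓝 (φ l), g x ∈ I :=
    hgd.continuousAt.eventually (by rw [hgl]; exact hI.mem_nhds hl)
  have hcomp := HasDerivAt.comp (φ l) (h₂ := f) (by rwa [hgl]) hgd
  refine (hcomp.congr_of_eventuallyEq ?_).congr_deriv (div_eq_mul_inv _ _).symm
  filter_upwards [hright, hmem] with x hx hxI
  rw [Function.comp_apply, ← hR _ hxI, hx]

lemma IsEquatorialNullGeodesic.deriv_azimuth_ne_zero {I : Set ℝ} {r φ : ℝ → ℝ} (hL : L ≠ 0)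
    (h : IsEquatorialNullGeodesic lam M Q E L I r φ) {l : ℝ} (hl : l ∈ I) : deriv φ l ≠ 0 :=
  fun h0 => hL (by rw [← (h.radialMotionAt hl).azimuth, h0, zero_mul])

lemma IsEquatorialNullGeodesic.isOpen_image {I : Set ℝ} {r φ : ℝ → ℝ} (hL : L ≠ 0)
    (h : IsEquatorialNullGeodesic lam M Q E L I r φ) : IsOpen (φ '' I) := by
  refine isOpen_iff_mem_nhds.2 ?_
  rintro _ ⟨l, hl, rfl⟩
  have hs := (h.radialMotionAt hl).contDiffAt_azimuth.hasStrictDerivAt (by norm_num)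
  rw [← hs.map_nhds_eq (h.deriv_azimuth_ne_zero hL hl)]
  exact image_mem_map (h.isOpen.mem_nhds hl)

lemma IsEquatorialNullGeodesic.isPreconnected_image {I : Set ℝ} {r φ : ℝ → ℝ}
    (h : IsEquatorialNullGeodesic lam M Q E L I r φ) : IsPreconnected (φ '' I) :=
  h.isPreconnected.image φ fun _ hl =>
    (h.radialMotionAt hl).contDiffAt_azimuth.continuousAt.continuousWithinAt

/-- The quartic of the polar orbit equation `(dr / dφ)² = δ r⁴ - r² + 2 M r - Q²`. -/
def orbitQuartic (δ M Q x : ℝ) : ℝ := δ * x ^ 4 - x ^ 2 + 2 * M * x - Q ^ 2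

/-- The orbit equations in polar parametrization. -/
theorem IsEquatorialNullGeodesic.orbit_eq {I : Set ℝ} {r φ R : ℝ → ℝ} (hL : L ≠ 0)
    (h : IsEquatorialNullGeodesic lam M Q E L I r φ) (hR : ∀ l ∈ I, R (φ l) = r l) :
    ∀ x ∈ φ '' I, HasDerivAt R (deriv R x) x ∧
      deriv R x ^ 2 = orbitQuartic (lam + E ^ 2 / L ^ 2) M Q (R x) ∧
      HasDerivAt (deriv R) (2 * (lam + E ^ 2 / L ^ 2) * R x ^ 3 - R x + M) x := by
  have hφ0 : ∀ l ∈ I, deriv φ l = L / r l ^ 2 := fun l hl => by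
    have hm := h.radialMotionAt hl
    rw [eq_div_iff (pow_ne_zero 2 hm.ne_zero), hm.azimuth]
  have hD : ∀ l ∈ I, HasDerivAt R (deriv r l * r l ^ 2 / L) (φ l) := fun l hl => by
    have hm := h.radialMotionAt hl
    refine (hasDerivAt_of_comp_eq h.isOpen hl hm.contDiffAt_azimuth
      (h.deriv_azimuth_ne_zero hL hl) (hm.contDiffAt_radius.differentiableAt (by norm_num)).hasDerivAt hR).congr_deriv ?_
    rw [hφ0 l hl]
    field_simp
  rintro _ ⟨l, hl, rfl⟩
  have hm := h.radialMotionAt hl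
  have hr := hm.ne_zero
  have hd := (hD l hl).deriv
  have henergy := hm.energy
  rw [horizonFn] at henergy
  refine ⟨(hD l hl).differentiableAt.hasDerivAt, ?_, ?_⟩
  · rw [hd, hR l hl, div_pow, mul_pow, henergy, orbitQuartic]
    field_simp
    ring
  -- The geodesic equation is needed here: differentiating the first-order equation would say
  -- nothing at a turning point.
  · have hr1 := (hm.contDiffAt_radius.differentiableAt (by norm_num)).hasDerivAt
    have hr2 : HasDerivAt (deriv r) (deriv (deriv r) l) l :=
      ((hm.contDiffAt_radius.derivWithin (m := 1) (by norm_num)).differentiableAt (by norm_num)).hasDerivAt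
    have hprod := (hr2.mul (hr1.pow 2)).div_const L
    refine (hasDerivAt_of_comp_eq h.isOpen hl hm.contDiffAt_azimuth
      (h.deriv_azimuth_ne_zero hL hl) hprod fun m hm => (hD m hm).deriv).congr_deriv ?_
    rw [hm.radius, hφ0 l hl, hR l hl, horizonFn, horizonFnDeriv]
    simp only [Nat.cast_ofNat, Nat.add_one_sub_one, pow_one, Pi.pow_apply]
    field_simp
    field_simp at henergy
    linear_combination 2 * henergy

end RNdS

/-! ### Matching the orbit with `℘` -/

/-- The Biermann–Weierstrass substitution `x = rbar + (α / 4) u` for a quartic with root `rbar`. -/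
lemma RNdS.orbitQuartic_eq_invQuartic {M Q rbar α β γ δ g₂ g₃ : ℝ}
    (hrbar : RNdS.orbitQuartic δ M Q rbar = 0) (hγ : γ = 4 * rbar * δ)
    (hβ : β = 6 * rbar ^ 2 * δ - 1) (hα : α = 4 * rbar ^ 3 * δ - 2 * rbar + 2 * M)
    (hg₂ : g₂ = 1 / 4 * (β ^ 2 / 3 - α * γ))
    (hg₃ : g₃ = 1 / 8 * (α * β * γ / 6 - α ^ 2 * δ / 2 - β ^ 3 / 27)) (u : ℝ) :
    RNdS.orbitQuartic δ M Q (rbar + α / 4 * u) = (α / 4) ^ 2 * invQuartic (β / 12) g₂ g₃ u ∧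
    2 * δ * (rbar + α / 4 * u) ^ 3 - (rbar + α / 4 * u) + M =
      α / 4 * invQuarticHalfDeriv (β / 12) g₂ g₃ u := by
  rw [RNdS.orbitQuartic] at hrbar ⊢
  have hM : M = (α - 4 * rbar ^ 3 * δ + 2 * rbar) / 2 := by rw [hα]; ring
  have hQ : Q ^ 2 = δ * rbar ^ 4 - rbar ^ 2 + 2 * M * rbar := by linear_combination -hrbar
  -- The values of `c`, `g₂` and `g₃` are those for which this matches the Taylor expansion `α y + β
  -- y² + γ y³ + δ y⁴` at `rbar`, with `y = (α / 4) u`.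
  have h1 : invQuartic (β / 12) g₂ g₃ u =
      4 * u + β * u ^ 2 + α * γ / 4 * u ^ 3 + α ^ 2 * δ / 16 * u ^ 4 := by
    rw [invQuartic, hg₂, hg₃]
    ring
  have h2 : invQuarticHalfDeriv (β / 12) g₂ g₃ u =
      2 + β * u + 3 / 8 * (α * γ) * u ^ 2 + α ^ 2 * δ / 8 * u ^ 3 := by
    rw [invQuarticHalfDeriv, hg₂, hg₃]
    ring
  rw [h1, h2, hQ, hM, hγ, hβ]
  constructor <;> ring

/-- A solution of the Weierstrass equation on an open interval agrees with `1 / (℘ - c)` along a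
line, if it does so to first order at one point. -/
lemma PeriodPair.invWP_line_eq_of_ode {Λ : PeriodPair} {c : ℂ} {z₀ : ℂ} {J : Set ℝ}
    (hJo : IsOpen J) (hJc : IsPreconnected J) {u u' : ℝ → ℂ}
    (hu : ∀ x ∈ J, HasDerivAt u (u' x) x ∧
      HasDerivAt u' (invQuarticHalfDeriv c Λ.g₂ Λ.g₃ (u x)) x)
    {x₀ : ℝ} (hx₀ : x₀ ∈ J) (hreg : z₀ + x₀ ∈ Λ.regularSet c) (h0 : Λ.invWP c (z₀ + x₀) = u x₀)
    (h0' : deriv (Λ.invWP c) (z₀ + x₀) = u' x₀) {x : ℝ} (hx : x ∈ J) :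
    z₀ + x ∈ Λ.regularSet c ∧ Λ.invWP c (z₀ + x) = u x := by
  set S : Set ℝ := {x | x ∈ J ∧ z₀ + x ∈ Λ.regularSet c ∧ Λ.invWP c (z₀ + x) = u x ∧
    deriv (Λ.invWP c) (z₀ + x) = u' x} with hS
  suffices J ⊆ S from ⟨(this hx).2.1, (this hx).2.2.1⟩
  -- The set `S` is open by local uniqueness, and closed in `J` because `u` stays finite, which
  -- keeps the line away from the poles.
  refine hJc.subset_of_closure_inter_subset ?_ ⟨x₀, hx₀, hx₀, hreg, h0, h0'⟩ ?_
  · refine isOpen_iff_mem_nhds.2 fun y ⟨hyJ, hyr, hy, hy'⟩ => ?_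
    have hnear : ∀ᶠ t : ℝ in 𝓝 y, z₀ + t ∈ Λ.regularSet c := by
      simpa using eventually_mem_regularSet_line (w := 1) (t₀ := y) (by simpa using hyr)
    have hV : ∀ᶠ t : ℝ in 𝓝 y,
        HasDerivAt (fun t : ℝ => Λ.invWP c (z₀ + t)) (deriv (Λ.invWP c) (z₀ + t)) t ∧
        HasDerivAt (fun t : ℝ => deriv (Λ.invWP c) (z₀ + t))
          (invQuarticHalfDeriv c Λ.g₂ Λ.g₃ (Λ.invWP c (z₀ + t))) t := by
      filter_upwards [hnear] with t ht
      simpa using hasDerivAt_invWP_comp_line (w := 1) (t := t) (by simpa using ht)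
    have hJy : ∀ᶠ t in 𝓝 y, t ∈ J := hJo.mem_nhds hyJ
    obtain ⟨h1, h2⟩ := eventuallyEq_of_second_order_ode
      (contDiff_invQuarticHalfDeriv c Λ.g₂ Λ.g₃) hV (hJy.mono hu) hy hy'
    filter_upwards [hJy, hnear, h1, h2] with t ht htr ht1 ht2
    exact ⟨ht, htr, ht1, ht2⟩
  · rintro y ⟨hyS, hyJ⟩
    obtain ⟨t, htS, ht⟩ := mem_closure_iff_seq_limit.1 hyS
    have hz : Tendsto (fun n => z₀ + (t n : ℂ)) atTop (𝓝 (z₀ + y)) :=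
      ((Complex.continuous_ofReal.tendsto y).comp ht).const_add z₀
    have hut : Tendsto (fun n => Λ.invWP c (z₀ + t n)) atTop (𝓝 (u y)) := by
      simp_rw [(htS _).2.2.1]
      exact (hu y hyJ).1.continuousAt.tendsto.comp ht
    have hyr := mem_regularSet_of_tendsto hz (Eventually.of_forall fun n => (htS n).2.1) hut
    have hA := analyticAt_invWP hyr
    refine ⟨hyJ, hyr, tendsto_nhds_unique (hA.continuousAt.tendsto.comp hz) hut,
      tendsto_nhds_unique (hA.deriv.continuousAt.tendsto.comp hz) ?_⟩
    simp_rw [Function.comp_def, (htS _).2.2.2]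
    exact (hu y hyJ).2.continuousAt.tendsto.comp ht

theorem corollary4p2
    -- the spacetime
    (lam M Q : ℝ) (hM : 0 ≤ M) (hQ : 0 ≤ Q)
    -- the data of the orbit
    (L E r₀ rdot₀ : ℝ) (hL : L ≠ 0) (hE : 0 < E) (hr₀ : 0 < r₀)
    (hLE : 0 ≤ lam * L ^ 2 + E ^ 2)
    -- the geodesic, its polar radius `R`, and the polar initial condition
    (I : Set ℝ) (r φ : ℝ → ℝ)
    (hgeo : RNdS.IsEquatorialNullGeodesic lam M Q E L I r φ)
    (R : ℝ → ℝ) (hR : ∀ l ∈ I, R (φ l) = r l)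
    (h0 : (0 : ℝ) ∈ φ '' I) (hR₀ : R 0 = r₀) (hRdot₀ : HasDerivAt R rdot₀ 0)
    -- the constants
    (rbar α β γ δ g₂ g₃ : ℝ)
    (hrbar : (lam + E ^ 2 / L ^ 2) * rbar ^ 4 - rbar ^ 2 + 2 * M * rbar - Q ^ 2 = 0)
    (hδ : δ = lam + E ^ 2 / L ^ 2)
    (hγ : γ = 4 * rbar * δ)
    (hβ : β = 6 * rbar ^ 2 * δ - 1)
    (hα : α = 4 * rbar ^ 3 * δ - 2 * rbar + 2 * M)
    (hg₂ : g₂ = 1 / 4 * (β ^ 2 / 3 - α * γ))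
    (hg₃ : g₃ = 1 / 8 * (α * β * γ / 6 - α ^ 2 * δ / 2 - β ^ 3 / 27))
    (hdisc : g₂ ^ 3 - 27 * g₃ ^ 2 ≠ 0)
    -- the period lattice with invariants `g₂`, `g₃`
    (Λ : PeriodPair) (hΛ₂ : Λ.g₂ = g₂) (hΛ₃ : Λ.g₃ = g₃)
    -- the roots of the Weierstrass cubic
    (z₁ z₂ z₃ : ℂ)
    (hz : ∀ s : ℂ, 4 * s ^ 3 - g₂ * s - g₃ = 4 * ((s - z₁) * (s - z₂) * (s - z₃)))
    -- the initial value of `℘` and the initial argument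
    (hne : r₀ ≠ rbar)
    (wp₀ : ℝ) (hwp₀ : wp₀ = α / (4 * (r₀ - rbar)) + β / 12)
    (z₀ : ℂ)
    (hz₀ : z₀ = (if 0 ≤ α * rdot₀ then 1 else -1) *
      RNdS.carlsonRF (wp₀ - z₁) (wp₀ - z₂) (wp₀ - z₃)) :
    -- the integral defining `z₀` converges
    IntegrableOn (RNdS.carlsonIntegrand (wp₀ - z₁) (wp₀ - z₂) (wp₀ - z₃)) (Ioi 0) ∧
    -- the formula, read as `R x = rbar` where `℘` has a pole
    ∀ x ∈ φ '' I,
      (z₀ + x ∉ Λ.lattice →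
        4 * Λ.weierstrassP (z₀ + x) - β / 3 ≠ 0 ∧
        (R x : ℂ) = rbar + α / (4 * Λ.weierstrassP (z₀ + x) - β / 3)) ∧
      (z₀ + x ∈ Λ.lattice → R x = rbar) := by
  refine ⟨(RNdS.integrableOn_carlsonIntegrand hdisc hz).1, ?_⟩
  rw [← hδ] at hrbar
  -- If `α = 0`, then `rbar` is a multiple root of the orbit quartic and the discriminant vanishes.
  have hα0 : α ≠ 0 := by
    intro h
    refine hdisc ?_
    rw [hg₂, hg₃, h]
    ring
  have ha0 : α / 4 ≠ 0 := div_ne_zero hα0 four_ne_zero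
  have hid := RNdS.orbitQuartic_eq_invQuartic hrbar hγ hβ hα hg₂ hg₃
  have horbit := hgeo.orbit_eq hL hR
  rw [← hδ] at horbit
  set u : ℝ → ℝ := fun x => (R x - rbar) / (α / 4) with hu
  have hRu : ∀ x, R x = rbar + α / 4 * u x := fun x => by
    simp only [hu]
    field_simp
    ring
  have hode : ∀ x ∈ φ '' I, HasDerivAt (fun x => (u x : ℂ)) ((deriv R x / (α / 4) : ℝ) : ℂ) x ∧
      HasDerivAt (fun x => ((deriv R x / (α / 4) : ℝ) : ℂ))
        (invQuarticHalfDeriv ((β / 12 : ℝ) : ℂ) Λ.g₂ Λ.g₃ (u x)) x := by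
    intro x hx
    obtain ⟨h1, -, h2⟩ := horbit x hx
    refine ⟨((h1.sub_const rbar).div_const (α / 4)).ofReal_comp, ?_⟩
    rw [hΛ₂, hΛ₃, ← ofReal_invQuarticHalfDeriv]
    refine HasDerivAt.ofReal_comp ((h2.div_const (α / 4)).congr_deriv ?_)
    rw [hRu x, (hid (u x)).2, mul_div_cancel_left₀ _ ha0]
  -- the initial data
  have hu0 : u 0 = 1 / (wp₀ - β / 12) := by
    simp only [hu, hR₀, hwp₀]
    have := sub_ne_zero.2 hne
    field_simp
    ring
  have hwc : wp₀ - β / 12 ≠ 0 := by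
    rw [hwp₀, add_sub_cancel_right]
    exact div_ne_zero hα0 (mul_ne_zero four_ne_zero (sub_ne_zero.2 hne))
  set p := 4 * wp₀ ^ 3 - g₂ * wp₀ - g₃ with hp
  -- From `u = 1 / (℘ - c)` and `u' = -℘' / (℘ - c)²`, this is the value that `-℘' z₀` must take.
  set q := rdot₀ / (α / 4) * (wp₀ - β / 12) ^ 2 with hq
  have hpq : p = q ^ 2 := by
    have h1 := (horbit 0 h0).2.1
    rw [hRdot₀.deriv, hRu 0, (hid (u 0)).1, hu0,
      invQuartic_eq_pow_mul _ _ _ (one_div_ne_zero hwc), one_div_one_div, add_sub_cancel,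
      ← hp] at h1
    rw [hq, mul_pow, div_pow, h1]
    generalize wp₀ - β / 12 = d at hwc ⊢
    field_simp
  obtain ⟨hl, hP, hP'⟩ := RNdS.weierstrassP_carlsonRF (wp₀ := wp₀) hΛ₂ hΛ₃ hdisc hz
  rw [← hp, hpq, principalSqrt_of_nonneg (sq_nonneg q), Real.sqrt_sq_eq_abs] at hP'
  have hinit : z₀ ∉ Λ.lattice ∧ Λ.weierstrassP z₀ = wp₀ ∧ Λ.derivWeierstrassP z₀ = -q := by
    -- Thus `q` has the sign of `α * rdot₀`. Carlson's integral yields `℘' = -|q|`, and since `℘` is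
    -- even and `℘'` odd, the sign `ε` repairs the case `q < 0`.
    have hqs : q = α * rdot₀ * (4 / α ^ 2 * (wp₀ - β / 12) ^ 2) := by
      rw [hq]
      field_simp
    have hpos : 0 < 4 / α ^ 2 * (wp₀ - β / 12) ^ 2 := by positivity
    split_ifs at hz₀ with hs
    · rw [one_mul] at hz₀
      rw [hz₀, hP', abs_of_nonneg (hqs ▸ mul_nonneg hs hpos.le)]
      exact ⟨hl, hP, rfl⟩
    · rw [neg_one_mul] at hz₀
      rw [hz₀, Λ.weierstrassP_neg, Λ.derivWeierstrassP_neg, hP',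
        abs_of_neg (hqs ▸ mul_neg_of_neg_of_pos (not_le.1 hs) hpos)]
      exact ⟨fun h => hl (neg_mem_iff.1 h), hP, by simp⟩
  obtain ⟨hl0, hP0, hP0'⟩ := hinit
  have hwcC : Λ.weierstrassP z₀ ≠ ((β / 12 : ℝ) : ℂ) := by
    rw [hP0]
    exact_mod_cast sub_ne_zero.1 hwc
  have key : ∀ x ∈ φ '' I, z₀ + x ∈ Λ.regularSet ((β / 12 : ℝ) : ℂ) ∧
      Λ.invWP ((β / 12 : ℝ) : ℂ) (z₀ + x) = u x := fun x hx => by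
    refine PeriodPair.invWP_line_eq_of_ode (hgeo.isOpen_image hL) hgeo.isPreconnected_image hode h0
      ?_ ?_ ?_ hx
    · rw [Complex.ofReal_zero, add_zero]
      exact Or.inr hwcC
    · rw [Complex.ofReal_zero, add_zero, PeriodPair.invWP_of_notMem hl0, hP0, hu0]
      push_cast
      rfl
    · rw [Complex.ofReal_zero, add_zero, PeriodPair.deriv_invWP_of_notMem hl0 hwcC, hP0, hP0',
        hRdot₀.deriv, neg_neg, ← Complex.ofReal_sub, ← Complex.ofReal_pow, ← Complex.ofReal_div, hq,
        mul_div_cancel_right₀ _ (pow_ne_zero 2 hwc)]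
  intro x hx
  obtain ⟨hreg, hU⟩ := key x hx
  refine ⟨fun hxl => ?_, fun hxl => ?_⟩
  · have hc := sub_ne_zero.2 (hreg.resolve_left hxl)
    have h4 : 4 * Λ.weierstrassP (z₀ + x) - β / 3 =
        4 * (Λ.weierstrassP (z₀ + x) - ((β / 12 : ℝ) : ℂ)) := by
      push_cast
      ring
    rw [h4]
    refine ⟨mul_ne_zero (by norm_num) hc, ?_⟩
    rw [PeriodPair.invWP_of_notMem hxl] at hU
    rw [hRu x, Complex.ofReal_add, Complex.ofReal_mul, ← hU]
    push_cast
    rw [div_mul_div_comm, mul_one]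
  · rw [PeriodPair.invWP_of_mem hxl] at hU
    rw [hRu x, Complex.ofReal_eq_zero.1 hU.symm, mul_zero, add_zero]
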